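/- Let $G=(V,E)$ be an infinite connected graph of bounded degree with maximal degree $K\in\mathbb N$, and let $V_1\subseteq V_2\subseteq\dots$ be finite vertex sets with $\bigcup_m V_m=V$ such that every induced subgraph $G_m=(V_m,E_m)$ is connected. Let $\beta>0$ and $u\in[0,1]$. **Random loop measure ($\theta=1$).** A link configuration on $G_m$ is a finite sequence $c=(e_i,s_i)_{1\le i\le n}$ with $n\ge 0$, $e_i\in E_m$, $s_i\in\{1,-1\}$ ($s_i=1$: cross, $s_i=-1$: double bar). $\mathbb P_m$ is the probability measure on link configurations with $$\mathbb P_m(\{c\})=e^{-\beta|E_m|}\,\frac{\beta^n}{n!}\,u^{\#\{i:s_i=1\}}(1-u)^{\#\{i:s_i=-1\}},$$ i.e. each edge carries an independent Poisson($\beta$) number of links, the links are put in uniformly random order, and each is independently a cross with probability $u$ and a double bar otherwise. **Loops.** Above every vertex $v\in V_m$ take segments $(v,0),\dots,(v,n)$, the $i$-th link lying between levels $i-1$ and $i$. Join $(v,0)$ with $(v,n)$; join $(v,i-1)$ with $(v,i)$ if $v\notin e_i$; if $e_i=\{v,w\}$ and $s_i=1$, join $(v,i-1)$ with $(w,i)$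 and $(w,i-1)$ with $(v,i)$; if $e_i=\{v,w\}$ and $s_i=-1$, join $(v,i-1)$ with $(w,i-1)$ and $(v,i)$ with $(w,i)$. Loops are the classes of the equivalence relation generated by these joinings. Write $v\stackrel{c}{\Longleftrightarrow}w$ if $(v,0)$ and $(w,0)$ lie in the same loop. For $v_0\in V_1$, loop percolation occurs (at $v_0$, along $(V_m)_{m\ge1}$) if $$\liminf_{R\to\infty}\liminf_{m\to\infty}\mathbb P_m\bigl(v_0\stackrel{c}{\Longleftrightarrow}w\text{ for some }w\in V_m\text{ with }d(v_0,w)\ge R\bigr)>0,$$ where $d$ is the graph distance of $G$. **Constants.** Let $p_{\rm c}(G)$ be the critical value of Bernoulli bond percolation on $G$, i.e. the supremum of all $p\in[0,1]$ for which there is almost surely no infinite open cluster when the edges are open independently with probability $p$, and let $$\delta(\beta,u,1)=\frac12\Bigl(\frac uK\Bigr)^2\frac{\beta}{\beta+3\cdot4^{K+1}}\Bigl(\frac{\beta}{e^\beta-1}\Bigr)^{2K-1}.$$ **Theorem.** If $(1-e^{-\beta})(1-\delta(\beta,u,1))<p_{\rm c}(G)$, then loop percolation does not occur, for any $v_0\in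 V_1$. -/

import Mathlib

open scoped ENNReal

noncomputable section

namespace RandomLoop

/-! ### Link configurations and loops on a finite graph -/

/-- A link on the graph `H`: an edge together with a type, `true` for a cross (`s = 1`) and `false`
for a double bar (`s = -1`). -/
abbrev Link {W : Type*} (H : SimpleGraph W) : Type _ := H.edgeSet × Bool

/-- A link configuration: a finite sequence of links. -/
abbrev LinkConfig {W : Type*} (H : SimpleGraph W) : Type _ := List (Link H)

/-- The graphical construction of loops. A configuration with `n` links cuts the vertical line above
each vertex `v` into the segments `(v, 0), …, (v, n)`, where the `i`-th link (`i = 0, …, n - 1`)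
sits between level `i` and level `i + 1`. The relation says which segments are joined:
* the time axis is periodic, so the bottom and the top segment above `v` are joined;
* a link that is not incident to `v` lets the line above `v` pass;
* a cross joins the segment below it at one end to the segment above it at the other end;
* a double bar joins the two segments below it, and the two segments above it. -/
inductive Joined {W : Type*} {H : SimpleGraph W} (c : LinkConfig H) :
    W × Fin (c.length + 1) → W × Fin (c.length + 1) → Prop
  | periodic (v : W) : Joined c (v, 0) (v, Fin.last c.length)
  | pass (i : Fin c.length) (v : W) (hv : v ∉ ((c.get i).1 : Sym2 W)) :
      Joined c (v, i.castSucc) (v, i.succ)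
  | cross (i : Fin c.length) (v w : W) (he : ((c.get i).1 : Sym2 W) = s(v, w))
      (hs : (c.get i).2 = true) : Joined c (v, i.castSucc) (w, i.succ)
  | barBelow (i : Fin c.length) (v w : W) (he : ((c.get i).1 : Sym2 W) = s(v, w))
      (hs : (c.get i).2 = false) : Joined c (v, i.castSucc) (w, i.castSucc)
  | barAbove (i : Fin c.length) (v w : W) (he : ((c.get i).1 : Sym2 W) = s(v, w))
      (hs : (c.get i).2 = false) : Joined c (v, i.succ) (w, i.succ)

/-- The loops of a configuration: the classes of segments under the equivalence relation generated
by `Joined`. -/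
def Loop {W : Type*} {H : SimpleGraph W} (c : LinkConfig H) : Type _ :=
  Quot (Joined c)

/-- `v` and `w` are connected by a loop: one and the same loop visits both of them at time `0`. -/
def LoopConnected {W : Type*} {H : SimpleGraph W} (c : LinkConfig H) (v w : W) : Prop :=
  ∃ L : Loop c, Quot.mk (Joined c) (v, 0) = L ∧ Quot.mk (Joined c) (w, 0) = L

/-! ### The random loop measure -/

/-- The unnormalised weight
`(β ^ n / n!) * u ^ #crosses * (1 - u) ^ #(double bars) * θ ^ #loops`
of a configuration with `n` links. -/
def weight {W : Type*} (H : SimpleGraph W) (β u θ : ℝ) (c : LinkConfig H) : ℝ≥0∞ :=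
  ENNReal.ofReal (β ^ c.length / (c.length.factorial : ℝ)
    * u ^ c.countP (fun l => l.2) * (1 - u) ^ c.countP (fun l => !l.2)
    * θ ^ Nat.card (Loop c))

theorem tsum_weight_ne_zero {W : Type*} (H : SimpleGraph W) (β u θ : ℝ) (hθ : 0 < θ) :
    ∑' c, weight H β u θ c ≠ 0 := by
  intro h
  have h0 := ENNReal.tsum_eq_zero.1 h []
  simp only [weight, List.length_nil, pow_zero, Nat.factorial_zero, Nat.cast_one, div_one,
    List.countP_nil, mul_one, one_mul, ENNReal.ofReal_eq_zero] at h0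
  exact absurd h0 (not_le.2 (pow_pos hθ _))

theorem card_loop_le {W : Type*} [Finite W] {H : SimpleGraph W} (c : LinkConfig H) :
    Nat.card (Loop c) ≤ Nat.card W * (c.length + 1) := by
  have h : Nat.card (Loop c) ≤ Nat.card (W × Fin (c.length + 1)) :=
    Nat.card_le_card_of_surjective (Quot.mk (Joined c)) Quot.mk_surjective
  simpa [Nat.card_prod] using h

theorem weight_le {W : Type*} [Finite W] (H : SimpleGraph W) (β u θ : ℝ) (c : LinkConfig H) :
    weight H β u θ c ≤ ENNReal.ofReal
      ((|β| * (1 + |u|) * (1 + |1 - u|) * (1 + |θ|) ^ Nat.card W) ^ c.length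
        / (c.length.factorial : ℝ) * (1 + |θ|) ^ Nat.card W) := by
  refine ENNReal.ofReal_le_ofReal ((le_abs_self _).trans ?_)
  have key : ∀ (x : ℝ) {a b : ℕ}, a ≤ b → |x| ^ a ≤ (1 + |x|) ^ b := fun x a b hab =>
    (pow_le_pow_left₀ (abs_nonneg x) (by linarith) a).trans
      (pow_le_pow_right₀ (by linarith [abs_nonneg x]) hab)
  rw [abs_mul, abs_mul, abs_mul, abs_div, abs_pow, abs_pow, abs_pow, abs_pow, Nat.abs_cast]
  calc |β| ^ c.length / (c.length.factorial : ℝ) * |u| ^ c.countP (fun l => l.2)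
        * |1 - u| ^ c.countP (fun l => !l.2) * |θ| ^ Nat.card (Loop c)
      ≤ |β| ^ c.length / (c.length.factorial : ℝ) * (1 + |u|) ^ c.length
        * (1 + |1 - u|) ^ c.length * (1 + |θ|) ^ (Nat.card W * (c.length + 1)) := by
        gcongr
        · exact key u List.countP_le_length
        · exact key (1 - u) List.countP_le_length
        · exact key θ (card_loop_le c)
    _ = _ := by
        rw [mul_add, pow_add, mul_one, pow_mul, mul_pow, mul_pow, mul_pow]
        ring

theorem tsum_weight_ne_top {W : Type*} [Finite W] (H : SimpleGraph W) (β u θ : ℝ) :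
    ∑' c, weight H β u θ c ≠ ∞ := by
  classical
  have := Fintype.ofFinite W
  have : Fintype (Link H) := Fintype.ofFinite _
  set A : ℝ := |β| * (1 + |u|) * (1 + |1 - u|) * (1 + |θ|) ^ Nat.card W with hA
  set D : ℝ := (1 + |θ|) ^ Nat.card W with hD
  set N : ℝ := (Fintype.card (Link H) : ℝ) with hN
  have hsum : Summable fun n : ℕ => (N * A) ^ n / (n.factorial : ℝ) * D :=
    (Real.summable_pow_div_factorial (N * A)).mul_right D
  refine ne_top_of_le_ne_top hsum.tsum_ofReal_ne_top ?_
  have hw : ∀ c : LinkConfig H, weight H β u θ c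
      ≤ ENNReal.ofReal (A ^ c.length / (c.length.factorial : ℝ) * D) := weight_le H β u θ
  clear_value A D
  refine (ENNReal.tsum_le_tsum hw).trans ?_
  rw [← (List.equivSigmaTuple (α := Link H)).symm.tsum_eq, ENNReal.tsum_sigma']
  refine ENNReal.tsum_le_tsum fun n => ?_
  simp only [List.equivSigmaTuple, Equiv.coe_fn_symm_mk, List.length_ofFn]
  rw [tsum_fintype, Finset.sum_const, nsmul_eq_mul, Finset.card_univ, Fintype.card_fun,
    Fintype.card_fin, ← ENNReal.ofReal_natCast, ← ENNReal.ofReal_mul (Nat.cast_nonneg _)]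
  refine ENNReal.ofReal_le_ofReal (le_of_eq ?_)
  rw [mul_pow, hN]
  push_cast
  ring

/-- The random loop measure with parameters `β`, `u`, `θ` on a finite graph: the probability measure
on link configurations that is proportional to `weight`. -/
def loopMeasure {W : Type*} [Finite W] (H : SimpleGraph W) (β u θ : ℝ) (hθ : 0 < θ) :
    PMF (LinkConfig H) :=
  PMF.normalize (weight H β u θ) (tsum_weight_ne_zero H β u θ hθ) (tsum_weight_ne_top H β u θ)

/-! ### Loop percolation and Bernoulli percolation on an infinite graph -/

/-- The event, on the subgraph of `G` induced by `S`, that `v₀` is connected by a loop to some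
vertex at distance at least `R` from `v₀`. -/
def reachesDistance {V : Type*} (G : SimpleGraph V) (S : Finset V) (v₀ : V) (R : ℕ) :
    Set (LinkConfig (G.induce (S : Set V))) :=
  {c | ∃ v w : (S : Set V), (v : V) = v₀ ∧ R ≤ G.dist v₀ w ∧ LoopConnected c v w}

/-- Loop percolation along the exhausting sequence `Λ 0 ⊆ Λ 1 ⊆ …` of finite vertex sets:
`liminf_{R → ∞} liminf_{m → ∞} P_m (v₀ ⇔ w for some w with d(v₀, w) ≥ R) > 0`, where `P_m` is the
random loop measure on the subgraph induced by `Λ m`. -/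
def LoopPercolation {V : Type*} (G : SimpleGraph V) (Λ : ℕ → Finset V) (v₀ : V)
    (β u θ : ℝ) (hθ : 0 < θ) : Prop :=
  0 < Filter.liminf (fun R : ℕ =>
    Filter.liminf (fun m : ℕ =>
      (loopMeasure (G.induce (Λ m : Set V)) β u θ hθ).toOuterMeasure
        (reachesDistance G (Λ m) v₀ R)) Filter.atTop) Filter.atTop

/-- The event that the graph formed by the set `ω` of open edges has an infinite cluster. -/
def hasInfiniteCluster (V : Type*) : Set (Set (Sym2 V)) :=
  {ω | ∃ v : V, {w : V | (SimpleGraph.fromEdgeSet ω).Reachable v w}.Infinite}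

/-- The critical value of Bernoulli bond percolation on `G`: the supremum of all `p ∈ [0, 1]` for
which, when the edges of `G` are open independently with probability `p`, there is almost surely no
infinite open cluster. -/
def criticalValue {V : Type*} (G : SimpleGraph V) : ℝ :=
  sSup {p : ℝ | ∃ hp : p ∈ unitInterval,
    ProbabilityTheory.setBernoulli G.edgeSet ⟨p, hp⟩ (hasInfiniteCluster V) = 0}

/-- The constant `δ(β, u, 1)` for maximal degree `K`. -/
def delta (K : ℕ) (β u : ℝ) : ℝ :=
  1 / 2 * (u / K) ^ 2 * (β / (β + 3 * 4 ^ (K + 1))) * (β / (Real.exp β - 1)) ^ (2 * K - 1)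

end RandomLoop

end

/-! A loop changes vertex only along an edge that carries a link, and those edges form a Bernoulli
field of density `1 - exp (-β)`. The gain `δ` comes from cancellation. If an edge carries exactly
two links, both crosses, and no adjacent edge has a link between them, the two swaps undo each
other. For connections at level `0` the edge might as well carry no link
(`LoopConnected.reachable`). It remains to dominate the effective edges, those which carry a link
and are not cancelled, by a Bernoulli field of density `(1 - exp (-β)) * (1 - δ)`.

Cancellation depends on neighbouring edges, and the following device controls the dependence. Colour
the edges properly with `C = 2 * K - 1` colours. Cut the time `β` into `C` short slots, one per
colour and of total length `β / 2`, and a last slot of length `β / 2`. Call an edge crossed if its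
links are exactly two crosses in the slot of its colour, late if all its links, at least one, are in
the last slot, and mixed if it has links of any other kind. A crossed edge without mixed neighbours
is cancelled, because its slot contains no link of an adjacent edge. The states of different edges
are independent, and each can be produced from three independent bits `O`, `P`, `X`: open, not
mixed, crossed (`tsum_listWeight_bits`).

The effective edges then lie in `O \ core P X`, where the core consists of the edges with `X` true
and `P` true on the whole closed neighbourhood. The core ignores `O`, so it is independent of it. A
local modification of `P` and `X` shows that the core contains any further edge with conditional
probability at least `r ^ m * s * (1 - s) ^ (m * m)`, with `m` a bound on the closed neighbourhoods
(`mul_bernoulliSum_core_le`). Hence it dominates a Bernoulli field of density `δ`, and `O \ core` is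
dominated by one of density `(1 - exp (-β)) * (1 - δ)` (`bernoulliSum_sdiff_core_le`,
`loopMeasure_le_bernoulliSum`).

Finally, choose `p` above this density without an infinite cluster. The bound by Bernoulli
percolation is uniform in `m`, and continuity from above in `R` makes it vanish
(`not_loopPercolation_of_le`). -/

noncomputable section

namespace RandomLoop

/-! ### Finite Bernoulli fields -/

section Bernoulli

variable {E : Type*} [DecidableEq E]

/-- The expectation of `g` of the random subset of `F` that contains each element of `F`
independently with probability `p`. -/
def bernoulliSum (p : ℝ) (F : Finset E) (g : Finset E → ℝ) : ℝ :=
  ∑ D ∈ F.powerset, p ^ D.card * (1 - p) ^ (F \ D).card * g D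

theorem bernoulliSum_empty (p : ℝ) (g : Finset E → ℝ) : bernoulliSum p ∅ g = g ∅ := by
  simp [bernoulliSum]

theorem bernoulliSum_insert (p : ℝ) {F : Finset E} {e : E} (he : e ∉ F) (g : Finset E → ℝ) :
    bernoulliSum p (insert e F) g
      = bernoulliSum p F (fun D => (1 - p) * g D + p * g (insert e D)) := by
  unfold bernoulliSum
  rw [Finset.sum_powerset_insert he, ← Finset.sum_add_distrib]
  refine Finset.sum_congr rfl fun D hD => ?_
  have hD' := Finset.mem_powerset.1 hD
  have heD : e ∉ D := fun h => he (hD' h)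
  rw [Finset.insert_sdiff_of_notMem _ heD, Finset.card_insert_of_notMem (by simp [he]),
    Finset.card_insert_of_notMem heD, Finset.insert_sdiff_insert, Finset.sdiff_insert_of_notMem he]
  ring

theorem bernoulliSum_congr {p : ℝ} {F : Finset E} {g h : Finset E → ℝ}
    (hgh : ∀ D ⊆ F, g D = h D) : bernoulliSum p F g = bernoulliSum p F h :=
  Finset.sum_congr rfl fun D hD => by rw [hgh D (Finset.mem_powerset.1 hD)]

theorem bernoulliSum_mono {p : ℝ} (h0 : 0 ≤ p) (h1 : p ≤ 1) {F : Finset E} {g h : Finset E → ℝ}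
    (hgh : ∀ D ⊆ F, g D ≤ h D) : bernoulliSum p F g ≤ bernoulliSum p F h :=
  Finset.sum_le_sum fun D hD => mul_le_mul_of_nonneg_left (hgh D (Finset.mem_powerset.1 hD))
    (mul_nonneg (pow_nonneg h0 _) (pow_nonneg (sub_nonneg.2 h1) _))

theorem bernoulliSum_nonneg {p : ℝ} (h0 : 0 ≤ p) (h1 : p ≤ 1) {F : Finset E} {g : Finset E → ℝ}
    (hg : ∀ D, 0 ≤ g D) : 0 ≤ bernoulliSum p F g :=
  Finset.sum_nonneg fun D _ => mul_nonneg
    (mul_nonneg (pow_nonneg h0 _) (pow_nonneg (sub_nonneg.2 h1) _)) (hg D)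

theorem bernoulliSum_const_mul (p r : ℝ) (F : Finset E) (g : Finset E → ℝ) :
    bernoulliSum p F (fun D => r * g D) = r * bernoulliSum p F g := by
  unfold bernoulliSum
  rw [Finset.mul_sum]
  exact Finset.sum_congr rfl fun D _ => by ring

theorem bernoulliSum_add (p : ℝ) (F : Finset E) (g h : Finset E → ℝ) :
    bernoulliSum p F (fun D => g D + h D) = bernoulliSum p F g + bernoulliSum p F h := by
  unfold bernoulliSum
  rw [← Finset.sum_add_distrib]
  exact Finset.sum_congr rfl fun D _ => by ring

theorem bernoulliSum_const (p r : ℝ) (F : Finset E) : bernoulliSum p F (fun _ => r) = r := by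
  induction F using Finset.induction_on with
  | empty => exact bernoulliSum_empty _ _
  | insert e F he ih =>
    rw [bernoulliSum_insert p he]
    exact (bernoulliSum_congr fun _ _ => by ring).trans ih

/-- An element survives if it lies in the first field and not in the second, independently of the
other elements; the induction integrates out one element at a time. -/
theorem bernoulliSum_sdiff (a d : ℝ) (F : Finset E) (f : Finset E → ℝ) :
    bernoulliSum a F (fun O => bernoulliSum d F (fun D => f (O \ D)))
      = bernoulliSum (a * (1 - d)) F f := by
  induction F using Finset.induction_on generalizing f with
  | empty => simp [bernoulliSum_empty]
  | insert e F he ih =>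
    rw [bernoulliSum_insert _ he, bernoulliSum_insert _ he, ← ih]
    refine bernoulliSum_congr fun O hO => ?_
    rw [bernoulliSum_insert _ he, bernoulliSum_insert _ he, ← bernoulliSum_const_mul,
      ← bernoulliSum_const_mul, ← bernoulliSum_add]
    refine bernoulliSum_congr fun D hD => ?_
    have heO : e ∉ O := fun h => he (hO h)
    have heD : e ∉ D := fun h => he (hD h)
    rw [Finset.insert_sdiff_of_notMem _ heD, Finset.insert_sdiff_insert,
      Finset.sdiff_insert_of_notMem heO]
    ring

/-- The usual monotone coupling, replaced by raising the density of one element at a time. -/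
theorem bernoulliSum_le_of_le {p q : ℝ} (h0 : 0 ≤ p) (hpq : p ≤ q) (h1 : q ≤ 1) (F : Finset E)
    {f : Finset E → ℝ} (hf : Monotone f) : bernoulliSum p F f ≤ bernoulliSum q F f := by
  induction F using Finset.induction_on generalizing f with
  | empty => simp [bernoulliSum_empty]
  | insert e F he ih =>
    rw [bernoulliSum_insert _ he, bernoulliSum_insert _ he]
    refine (bernoulliSum_mono h0 (hpq.trans h1) fun D _ => ?_).trans (ih ?_)
    · have := hf (Finset.subset_insert e D)
      nlinarith
    · intro D D' hDD
      have h2 := hf hDD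
      have h3 := hf (Finset.insert_subset_insert e hDD)
      have h4 : 0 ≤ q := h0.trans hpq
      exact add_le_add (mul_le_mul_of_nonneg_left h2 (by linarith))
        (mul_le_mul_of_nonneg_left h3 h4)

/-- A random set `B` that contains each further element `e` with conditional probability at least
`d`, given its trace on any set `F` not containing `e`, dominates a Bernoulli field. -/
theorem sum_antitone_le_bernoulliSum {Ω : Type*} [Fintype Ω] (W : Ω → ℝ)
    (B : Ω → Finset E) {d : ℝ} (h0 : 0 ≤ d) (h1 : d ≤ 1)
    (hB : ∀ (F : Finset E) (e : E), e ∉ F → ∀ η : Finset E,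
      d * ∑ ω, (if B ω ∩ F = η then W ω else 0)
        ≤ ∑ ω, if B ω ∩ F = η ∧ e ∈ B ω then W ω else 0)
    (F : Finset E) {g : Finset E → ℝ} (hg : Antitone g) :
    ∑ ω, W ω * g (B ω ∩ F) ≤ (∑ ω, W ω) * bernoulliSum d F g := by
  induction F using Finset.induction_on generalizing g with
  | empty => simp [bernoulliSum_empty, Finset.sum_mul]
  | insert e F he ih =>
    rw [bernoulliSum_insert _ he]
    refine le_trans ?_ (ih ?_)
    -- The drop of `g` caused by `e`. It is nonnegative and depends only on the trace on `F`, so the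
    -- conditional bound can be applied on each fibre of that trace.
    · set h : Finset E → ℝ := fun D => g D - g (insert e D) with hh
      have hh0 : ∀ D, 0 ≤ h D := fun D => sub_nonneg.2 (hg (Finset.subset_insert e D))
      have key : d * ∑ ω, W ω * h (B ω ∩ F)
          ≤ ∑ ω, (if e ∈ B ω then W ω else 0) * h (B ω ∩ F) := by
        rw [← Finset.sum_fiberwise_of_maps_to (s := Finset.univ) (t := F.powerset)
            (g := fun ω => B ω ∩ F) (fun ω _ => Finset.mem_powerset.2 Finset.inter_subset_right),
          ← Finset.sum_fiberwise_of_maps_to (s := Finset.univ) (t := F.powerset)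
            (g := fun ω => B ω ∩ F) (fun ω _ => Finset.mem_powerset.2 Finset.inter_subset_right),
          Finset.mul_sum]
        refine Finset.sum_le_sum fun η _ => ?_
        have e1 : ∑ ω with B ω ∩ F = η, W ω * h (B ω ∩ F)
            = h η * ∑ ω, (if B ω ∩ F = η then W ω else 0) := by
          rw [Finset.sum_filter, Finset.mul_sum]
          refine Finset.sum_congr rfl fun ω _ => ?_
          split_ifs with h1
          · rw [h1, mul_comm]
          · simp
        have e2 : ∑ ω with B ω ∩ F = η, (if e ∈ B ω then W ω else 0) * h (B ω ∩ F)
            = h η * ∑ ω, (if B ω ∩ F = η ∧ e ∈ B ω then W ω else 0) := by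
          rw [Finset.sum_filter, Finset.mul_sum]
          refine Finset.sum_congr rfl fun ω _ => ?_
          by_cases h1 : B ω ∩ F = η
          · simp only [h1, if_true, true_and]; rw [mul_comm]
          · simp [h1]
        rw [e1, e2]
        have := mul_le_mul_of_nonneg_left (hB F e he η) (hh0 η)
        linarith
      have e3 : ∑ ω, W ω * g (B ω ∩ insert e F)
          = ∑ ω, W ω * g (B ω ∩ F) - ∑ ω, (if e ∈ B ω then W ω else 0) * h (B ω ∩ F) := by
        rw [← Finset.sum_sub_distrib]
        refine Finset.sum_congr rfl fun ω _ => ?_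
        by_cases h1 : e ∈ B ω
        · rw [Finset.inter_insert_of_mem h1, if_pos h1, hh]; ring
        · rw [Finset.inter_insert_of_notMem h1, if_neg h1]; ring
      have e4 : ∑ ω, W ω * ((1 - d) * g (B ω ∩ F) + d * g (insert e (B ω ∩ F)))
          = ∑ ω, W ω * g (B ω ∩ F) - d * ∑ ω, W ω * h (B ω ∩ F) := by
        rw [Finset.mul_sum, ← Finset.sum_sub_distrib]
        refine Finset.sum_congr rfl fun ω _ => ?_
        rw [hh]; ring
      rw [e3, e4]
      linarith
    · intro D D' hDD
      exact add_le_add (mul_le_mul_of_nonneg_left (hg hDD) (by linarith))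
        (mul_le_mul_of_nonneg_left (hg (Finset.insert_subset_insert e hDD)) h0)

/-! ### Finite energy and the core -/

variable [Fintype E]

/-- Resampling a single element; dropping one of the two terms gives the cost of forcing it. -/
theorem bernoulliSum_univ_split (p : ℝ) (e : E) (g : Finset E → ℝ) :
    bernoulliSum p Finset.univ g
      = bernoulliSum p Finset.univ (fun D => (1 - p) * g (D.erase e) + p * g (insert e D)) := by
  have hu : (Finset.univ : Finset E) = insert e (Finset.univ.erase e) := by simp
  rw [hu, bernoulliSum_insert p (Finset.notMem_erase _ _),
    bernoulliSum_insert p (Finset.notMem_erase _ _)]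
  refine bernoulliSum_congr fun D hD => ?_
  have heD : e ∉ D := fun h => by simpa using hD h
  rw [Finset.erase_eq_of_notMem heD, Finset.erase_insert heD, Finset.insert_idem]
  ring

/-- Forcing the elements of `S` to be present costs at most a factor `p ^ S.card`. -/
theorem pow_mul_bernoulliSum_union_le {p : ℝ} (h0 : 0 ≤ p) (h1 : p ≤ 1) (S : Finset E)
    {g : Finset E → ℝ} (hg : ∀ D, 0 ≤ g D) :
    p ^ S.card * bernoulliSum p Finset.univ (fun D => g (D ∪ S))
      ≤ bernoulliSum p Finset.univ g := by
  induction S using Finset.induction_on generalizing g with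
  | empty => simp
  | insert e S he ih =>
    rw [Finset.card_insert_of_notMem he, pow_succ, mul_assoc, ← bernoulliSum_const_mul]
    have h2 := ih (g := fun D => p * g (insert e D)) fun D => mul_nonneg h0 (hg _)
    simp only [Finset.union_insert] at h2 ⊢
    refine h2.trans ?_
    rw [bernoulliSum_univ_split p e g]
    exact bernoulliSum_mono h0 h1 fun D _ =>
      le_add_of_nonneg_left (mul_nonneg (by linarith) (hg _))

/-- Forcing the elements of `S` to be absent costs at most a factor `(1 - p) ^ S.card`. -/
theorem pow_mul_bernoulliSum_sdiff_le {p : ℝ} (h0 : 0 ≤ p) (h1 : p ≤ 1) (S : Finset E)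
    {g : Finset E → ℝ} (hg : ∀ D, 0 ≤ g D) :
    (1 - p) ^ S.card * bernoulliSum p Finset.univ (fun D => g (D \ S))
      ≤ bernoulliSum p Finset.univ g := by
  induction S using Finset.induction_on generalizing g with
  | empty => simp
  | insert e S he ih =>
    rw [Finset.card_insert_of_notMem he, pow_succ, mul_assoc, ← bernoulliSum_const_mul]
    have h2 := ih (g := fun D => (1 - p) * g (D.erase e)) fun D =>
      mul_nonneg (by linarith) (hg _)
    simp only [Finset.sdiff_insert] at h2 ⊢
    refine h2.trans ?_
    rw [bernoulliSum_univ_split p e g]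
    exact bernoulliSum_mono h0 h1 fun D _ => le_add_of_nonneg_right (mul_nonneg h0 (hg _))

/-- The elements of `X` whose whole neighbourhood lies in `P`. -/
def core (N : E → Finset E) (P X : Finset E) : Finset E :=
  Finset.univ.filter fun e => e ∈ X ∧ N e ⊆ P

theorem mem_core {N : E → Finset E} {P X : Finset E} {e : E} :
    e ∈ core N P X ↔ e ∈ X ∧ N e ⊆ P := by simp [core]

/-- Finite energy of the core: the local change that makes `e` a member of it and keeps its trace on
`F` has a bounded cost. -/
theorem mul_bernoulliSum_core_le (N : E → Finset E) {m : ℕ} (hcard : ∀ e, (N e).card ≤ m)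
    (hsymm : ∀ e f, f ∈ N e → e ∈ N f) {r s d : ℝ} (hr0 : 0 ≤ r) (hr1 : r ≤ 1) (hs0 : 0 ≤ s)
    (hs1 : s ≤ 1) (hd : d ≤ r ^ m * (s * (1 - s) ^ (m * m))) (F : Finset E) (e : E) (he : e ∉ F)
    (η : Finset E) :
    d * bernoulliSum r Finset.univ (fun P => bernoulliSum s Finset.univ fun X =>
        if core N P X ∩ F = η then 1 else 0)
      ≤ bernoulliSum r Finset.univ (fun P => bernoulliSum s Finset.univ fun X =>
        if core N P X ∩ F = η ∧ e ∈ core N P X then 1 else 0) := by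
  classical
  set A : Finset E → Finset E → ℝ := fun P X => if core N P X ∩ F = η then 1 else 0 with hA
  set C : Finset E → Finset E → ℝ := fun P X =>
    if core N P X ∩ F = η ∧ e ∈ core N P X then 1 else 0 with hC
  have hA0 : ∀ P X, 0 ≤ A P X := fun P X => by simp only [hA]; split_ifs <;> norm_num
  have hC0 : ∀ P X, 0 ≤ C P X := fun P X => by simp only [hC]; split_ifs <;> norm_num
  -- Adding `N e` to `P` could bring unwanted elements of `F \ η` into the core. Only elements with
  -- a neighbour in `N e` are at risk, and there are at most `m * m` of them; they are deleted from
  -- `X`.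
  set S : Finset E := (((N e).biUnion N) ∩ (F \ η)) with hS
  have hSc : S.card ≤ m * m := by
    refine (Finset.card_le_card Finset.inter_subset_left).trans ?_
    refine (Finset.card_biUnion_le_card_mul _ _ m fun f _ => hcard f).trans ?_
    exact Nat.mul_le_mul_right _ (hcard e)
  have heS : e ∉ S := fun h => he (Finset.mem_sdiff.1 (Finset.mem_inter.1 h).2).1
  have hAC : ∀ P X, A P X ≤ C (P ∪ N e) ((X \ S) ∪ {e}) := by
    intro P X
    by_cases h : core N P X ∩ F = η
    · have h2 : core N (P ∪ N e) ((X \ S) ∪ {e}) ∩ F = η := by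
        subst h
        ext f
        simp only [Finset.mem_inter, mem_core, Finset.mem_union, Finset.mem_sdiff,
          Finset.mem_singleton]
        constructor
        · rintro ⟨⟨hfX, hfN⟩, hfF⟩
          have hfe : f ≠ e := fun h => he (h ▸ hfF)
          obtain ⟨hfX, hfS⟩ := hfX.resolve_right hfe
          refine ⟨⟨hfX, fun x hx => ?_⟩, hfF⟩
          by_contra hxP
          have hxe : x ∈ N e := (Finset.mem_union.1 (hfN hx)).resolve_left hxP
          refine hfS (Finset.mem_inter.2 ⟨Finset.mem_biUnion.2 ⟨x, hxe, hsymm _ _ hx⟩, ?_⟩)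
          refine Finset.mem_sdiff.2 ⟨hfF, fun h => ?_⟩
          exact hxP ((mem_core.1 (Finset.mem_inter.1 h).1).2 hx)
        · rintro ⟨⟨hfX, hfN⟩, hfF⟩
          refine ⟨⟨Or.inl ⟨hfX, fun h => ?_⟩, hfN.trans Finset.subset_union_left⟩, hfF⟩
          exact (Finset.mem_sdiff.1 (Finset.mem_inter.1 h).2).2
            (Finset.mem_inter.2 ⟨mem_core.2 ⟨hfX, hfN⟩, hfF⟩)
      have h3 : e ∈ core N (P ∪ N e) ((X \ S) ∪ {e}) :=
        mem_core.2 ⟨by simp, Finset.subset_union_right⟩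
      simp only [hA, hC, h, h2, h3, and_self, if_true, le_refl]
    · simp only [hA, h, if_false]
      exact hC0 _ _
  have inner : ∀ P : Finset E, s * (1 - s) ^ (m * m) * bernoulliSum s Finset.univ (A P)
      ≤ bernoulliSum s Finset.univ (C (P ∪ N e)) := by
    intro P
    have h1s : 0 ≤ 1 - s := by linarith
    calc s * (1 - s) ^ (m * m) * bernoulliSum s Finset.univ (A P)
        ≤ s * ((1 - s) ^ S.card * bernoulliSum s Finset.univ (A P)) := by
          rw [mul_assoc]
          refine mul_le_mul_of_nonneg_left (mul_le_mul_of_nonneg_right ?_ ?_) hs0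
          · exact pow_le_pow_of_le_one h1s (by linarith) hSc
          · exact bernoulliSum_nonneg hs0 hs1 (hA0 P)
      _ ≤ s * ((1 - s) ^ S.card * bernoulliSum s Finset.univ
            (fun X => C (P ∪ N e) ((X \ S) ∪ {e}))) := by
          refine mul_le_mul_of_nonneg_left (mul_le_mul_of_nonneg_left ?_ (pow_nonneg h1s _)) hs0
          exact bernoulliSum_mono hs0 hs1 fun X _ => hAC P X
      _ ≤ s * bernoulliSum s Finset.univ (fun X => C (P ∪ N e) (X ∪ {e})) :=
          mul_le_mul_of_nonneg_left (pow_mul_bernoulliSum_sdiff_le hs0 hs1 S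
            (g := fun X => C (P ∪ N e) (X ∪ {e})) fun X => hC0 _ _) hs0
      _ ≤ _ := by
          simpa using pow_mul_bernoulliSum_union_le hs0 hs1 {e} (g := C (P ∪ N e))
            fun X => hC0 _ _
  have hAsum : 0 ≤ bernoulliSum r Finset.univ (fun P => bernoulliSum s Finset.univ (A P)) :=
    bernoulliSum_nonneg hr0 hr1 fun P => bernoulliSum_nonneg hs0 hs1 (hA0 P)
  calc d * bernoulliSum r Finset.univ (fun P => bernoulliSum s Finset.univ (A P))
      ≤ r ^ m * (s * (1 - s) ^ (m * m))
          * bernoulliSum r Finset.univ (fun P => bernoulliSum s Finset.univ (A P)) :=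
        mul_le_mul_of_nonneg_right hd hAsum
    _ = r ^ m * bernoulliSum r Finset.univ
          (fun P => s * (1 - s) ^ (m * m) * bernoulliSum s Finset.univ (A P)) := by
        rw [bernoulliSum_const_mul]; ring
    _ ≤ r ^ m * bernoulliSum r Finset.univ
          (fun P => bernoulliSum s Finset.univ (C (P ∪ N e))) :=
        mul_le_mul_of_nonneg_left (bernoulliSum_mono hr0 hr1 fun P _ => inner P)
          (pow_nonneg hr0 _)
    _ ≤ r ^ (N e).card * bernoulliSum r Finset.univ
          (fun P => bernoulliSum s Finset.univ (C (P ∪ N e))) := by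
        refine mul_le_mul_of_nonneg_right (pow_le_pow_of_le_one hr0 hr1 (hcard e)) ?_
        exact bernoulliSum_nonneg hr0 hr1 fun P => bernoulliSum_nonneg hs0 hs1 (hC0 _)
    _ ≤ _ := pow_mul_bernoulliSum_union_le hr0 hr1 (N e)
        (g := fun P => bernoulliSum s Finset.univ (C P))
        fun P => bernoulliSum_nonneg hs0 hs1 (hC0 P)

/-- Puts the pair of fields on one finite weighted space, the form needed by
`sum_antitone_le_bernoulliSum`. -/
theorem bernoulliSum_bernoulliSum_eq_sum (r s : ℝ) (f : Finset E → Finset E → ℝ) :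
    bernoulliSum r Finset.univ (fun P => bernoulliSum s Finset.univ (f P))
      = ∑ ω : Finset E × Finset E, (r ^ ω.1.card * (1 - r) ^ (Finset.univ \ ω.1).card *
          (s ^ ω.2.card * (1 - s) ^ (Finset.univ \ ω.2).card)) * f ω.1 ω.2 := by
  unfold bernoulliSum
  rw [Finset.powerset_univ, Fintype.sum_prod_type]
  refine Finset.sum_congr rfl fun P _ => ?_
  rw [Finset.mul_sum]
  exact Finset.sum_congr rfl fun X _ => by ring

/-- Removing the core of an independent field from a Bernoulli field leaves a set that is dominated
by a sparser Bernoulli field. -/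
theorem bernoulliSum_sdiff_core_le (N : E → Finset E) {m : ℕ} (hcard : ∀ e, (N e).card ≤ m)
    (hsymm : ∀ e f, f ∈ N e → e ∈ N f) {a r s d : ℝ} (ha0 : 0 ≤ a) (ha1 : a ≤ 1)
    (hr0 : 0 ≤ r) (hr1 : r ≤ 1) (hs0 : 0 ≤ s) (hs1 : s ≤ 1) (hd0 : 0 ≤ d) (hd1 : d ≤ 1)
    (hd : d ≤ r ^ m * (s * (1 - s) ^ (m * m))) {f : Finset E → ℝ} (hf : Monotone f) :
    bernoulliSum a Finset.univ (fun O => bernoulliSum r Finset.univ fun P =>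
        bernoulliSum s Finset.univ fun X => f (O \ core N P X))
      ≤ bernoulliSum (a * (1 - d)) Finset.univ f := by
  rw [← bernoulliSum_sdiff]
  refine bernoulliSum_mono ha0 ha1 fun O _ => ?_
  set W : Finset E × Finset E → ℝ := fun ω => r ^ ω.1.card * (1 - r) ^ (Finset.univ \ ω.1).card *
          (s ^ ω.2.card * (1 - s) ^ (Finset.univ \ ω.2).card) with hW
  have hWsum : ∑ ω, W ω = 1 := by
    have := bernoulliSum_bernoulliSum_eq_sum (E := E) r s (fun _ _ => 1)
    simp only [bernoulliSum_const, mul_one] at this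
    exact this.symm
  have key := sum_antitone_le_bernoulliSum W (fun ω => core N ω.1 ω.2) hd0 hd1 ?_
    Finset.univ (g := fun D => f (O \ D)) fun D D' h => hf (Finset.sdiff_subset_sdiff le_rfl h)
  · rw [hWsum, one_mul] at key
    rw [bernoulliSum_bernoulliSum_eq_sum r s fun P X => f (O \ core N P X)]
    simpa only [Finset.inter_univ] using key
  · intro F e he η
    have := mul_bernoulliSum_core_le N hcard hsymm hr0 hr1 hs0 hs1 hd F e he η
    rw [bernoulliSum_bernoulliSum_eq_sum r s, bernoulliSum_bernoulliSum_eq_sum r s] at this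
    simpa only [hW, mul_ite, mul_one, mul_zero] using this

end Bernoulli

/-! ### Cancelling pairs of crosses -/

section Cancel

variable {W : Type*} {H : SimpleGraph W} [DecidableEq H.edgeSet]

/-- The number of links at `e` among the first `k` links. -/
def countBefore (c : LinkConfig H) (k : ℕ) (e : H.edgeSet) : ℕ :=
  ((c.take k).map Prod.fst).count e

/-- The edge `e` carries exactly two links, both of them crosses, and no link at an adjacent edge
lies between them. -/
structure IsCancelled (c : LinkConfig H) (e : H.edgeSet) : Prop where
  cross : ∀ l ∈ c, l.1 = e → l.2 = true
  count : (c.map Prod.fst).count e = 2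
  separated : ∀ i : Fin c.length, (c.get i).1 ≠ e →
    (∃ v, v ∈ ((c.get i).1 : Sym2 W) ∧ v ∈ (e : Sym2 W)) → countBefore c i e ≠ 1

/-- The edges that carry a link and are not cancelled. -/
def effectiveEdges (c : LinkConfig H) : Set H.edgeSet :=
  {e | e ∈ c.map Prod.fst ∧ ¬ IsCancelled c e}

theorem countBefore_zero (c : LinkConfig H) (e : H.edgeSet) : countBefore c 0 e = 0 := by
  simp [countBefore]

theorem countBefore_length (c : LinkConfig H) (e : H.edgeSet) :
    countBefore c c.length e = (c.map Prod.fst).count e := by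
  simp [countBefore]

theorem countBefore_succ (c : LinkConfig H) (i : Fin c.length) (e : H.edgeSet) :
    countBefore c (i + 1) e = countBefore c i e + if (c.get i).1 = e then 1 else 0 := by
  unfold countBefore
  rw [List.take_succ_eq_append_getElem i.2, List.map_append, List.count_append]
  rw [List.map_singleton, List.count_singleton, ← List.get_eq_getElem]
  simp only [beq_iff_eq]

theorem countBefore_succ_self (c : LinkConfig H) (i : Fin c.length) :
    countBefore c (i + 1) (c.get i).1 = countBefore c i (c.get i).1 + 1 := by
  rw [countBefore_succ, if_pos rfl]

theorem countBefore_succ_of_ne (c : LinkConfig H) (i : Fin c.length) {e : H.edgeSet}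
    (h : (c.get i).1 ≠ e) : countBefore c (i + 1) e = countBefore c i e := by
  rw [countBefore_succ, if_neg h, add_zero]

theorem countBefore_le (c : LinkConfig H) (k : ℕ) (e : H.edgeSet) :
    countBefore c k e ≤ (c.map Prod.fst).count e :=
  ((List.take_sublist k c).map Prod.fst).count_le e

/-- The windows between the two crosses of adjacent cancelled edges are disjoint: going down from
level `k`, the last link at `e` or `f` would lie inside the window of the other edge. This makes
`origin` well defined. -/
theorem IsCancelled.eq_of_countBefore {c : LinkConfig H} {e f : H.edgeSet} (he : IsCancelled c e)
    (hf : IsCancelled c f) {v : W} (hve : v ∈ (e : Sym2 W)) (hvf : v ∈ (f : Sym2 W)) {k : ℕ}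
    (hk : k ≤ c.length) (he1 : countBefore c k e = 1) (hf1 : countBefore c k f = 1) : e = f := by
  by_contra hef
  induction k with
  | zero => simp [countBefore_zero] at he1
  | succ k ih =>
    let i : Fin c.length := ⟨k, hk⟩
    have hi : k = (i : ℕ) := rfl
    rw [hi] at he1 hf1
    by_cases h1 : (c.get i).1 = e
    · have h2 : (c.get i).1 ≠ f := fun h => hef (h1.symm.trans h)
      rw [countBefore_succ_of_ne c i h2] at hf1
      exact hf.separated i h2 ⟨v, h1 ▸ hve, hvf⟩ hf1
    · by_cases h2 : (c.get i).1 = f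
      · rw [countBefore_succ_of_ne c i h1] at he1
        exact he.separated i h1 ⟨v, h2 ▸ hvf, hve⟩ he1
      · rw [countBefore_succ_of_ne c i h1] at he1
        rw [countBefore_succ_of_ne c i h2] at hf1
        exact ih (by omega) he1 hf1

/-! ### Following a line through cancelled crosses -/

open Classical in
/-- The vertex from which the segment `(v, k)` stems: the other end of `e` while `v` lies between
the two crosses of a cancelled edge `e`, and `v` itself otherwise. -/
def origin (c : LinkConfig H) (k : ℕ) (v : W) : W :=
  -- The chosen edge is unique for `k ≤ c.length`, by `IsCancelled.eq_of_countBefore`.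
  if h : ∃ e : H.edgeSet, v ∈ (e : Sym2 W) ∧ IsCancelled c e ∧ countBefore c k e = 1 then
    Sym2.Mem.other h.choose_spec.1 else v

theorem origin_eq_self {c : LinkConfig H} {k : ℕ} {v : W}
    (h : ∀ e : H.edgeSet, v ∈ (e : Sym2 W) → IsCancelled c e → countBefore c k e ≠ 1) :
    origin c k v = v :=
  dif_neg fun ⟨e, h1, h2, h3⟩ => h e h1 h2 h3

theorem origin_eq_other {c : LinkConfig H} {k : ℕ} (hk : k ≤ c.length) {v w : W} {e : H.edgeSet}
    (he : IsCancelled c e) (hvw : (e : Sym2 W) = s(v, w)) (h1 : countBefore c k e = 1) :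
    origin c k v = w := by
  have hv : v ∈ (e : Sym2 W) := by simp [hvw]
  have h : ∃ e : H.edgeSet, v ∈ (e : Sym2 W) ∧ IsCancelled c e ∧ countBefore c k e = 1 :=
    ⟨e, hv, he, h1⟩
  rw [origin, dif_pos h]
  have hs := h.choose_spec
  have hee : h.choose = e := hs.2.1.eq_of_countBefore he hs.1 hv hk hs.2.2 h1
  have h3 : s(v, Sym2.Mem.other hs.1) = s(v, w) := by
    rw [Sym2.other_spec hs.1, hee, hvw]
  exact Sym2.congr_right.1 h3

theorem origin_pass {c : LinkConfig H} (i : Fin c.length) {v : W}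
    (hv : v ∉ ((c.get i).1 : Sym2 W)) : origin c (i + 1) v = origin c i v := by
  have hne : ∀ e : H.edgeSet, v ∈ (e : Sym2 W) → (c.get i).1 ≠ e := fun e h1 h2 => hv (h2 ▸ h1)
  by_cases h : ∃ e : H.edgeSet, v ∈ (e : Sym2 W) ∧ IsCancelled c e ∧ countBefore c i e = 1
  · obtain ⟨e, h1, h2, h3⟩ := h
    obtain ⟨w, hw⟩ := Sym2.mem_iff_exists.1 h1
    rw [origin_eq_other i.2.le h2 hw h3,
      origin_eq_other i.2 h2 hw (by rw [countBefore_succ_of_ne c i (hne e h1), h3])]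
  · rw [origin_eq_self fun e h1 h2 h3 => h ⟨e, h1, h2, h3⟩, origin_eq_self]
    intro e h1 h2 h3
    rw [countBefore_succ_of_ne c i (hne e h1)] at h3
    exact h ⟨e, h1, h2, h3⟩

/-- A link at `v` outside the cancelled edges cannot fall into the window of a cancelled edge at
`v`, so the line at `v` is undisturbed just below and just above it. -/
theorem origin_of_not_isCancelled {c : LinkConfig H} (i : Fin c.length)
    (hi : ¬ IsCancelled c (c.get i).1) {v : W} (hv : v ∈ ((c.get i).1 : Sym2 W)) :
    origin c i v = v ∧ origin c (i + 1) v = v := by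
  have hne : ∀ e : H.edgeSet, IsCancelled c e → (c.get i).1 ≠ e := fun e h1 h2 => hi (h2 ▸ h1)
  constructor
  · exact origin_eq_self fun e h1 h2 => h2.separated i (hne e h2) ⟨v, hv, h1⟩
  · refine origin_eq_self fun e h1 h2 => ?_
    rw [countBefore_succ_of_ne c i (hne e h2)]
    exact h2.separated i (hne e h2) ⟨v, hv, h1⟩

/-- The first cross moves the line of `v` to `w`, the second moves it back; no other cancelled edge
at these vertices has its window open at this moment. -/
theorem origin_cross {c : LinkConfig H} (i : Fin c.length) (hi : IsCancelled c (c.get i).1)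
    {v w : W} (hvw : ((c.get i).1 : Sym2 W) = s(v, w)) : origin c i v = origin c (i + 1) w := by
  have hs := countBefore_succ_self c i
  have hle := countBefore_le c (i + 1) (c.get i).1
  rw [hi.count] at hle
  have hv : v ∈ ((c.get i).1 : Sym2 W) := hvw ▸ Sym2.mem_mk_left v w
  have hw : w ∈ ((c.get i).1 : Sym2 W) := hvw ▸ Sym2.mem_mk_right v w
  obtain h0 | h1 : countBefore c i (c.get i).1 = 0 ∨ countBefore c i (c.get i).1 = 1 := by omega
  · have h1 : countBefore c (i + 1) (c.get i).1 = 1 := by omega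
    rw [origin_eq_other (v := w) (w := v) i.2 hi (hvw.trans Sym2.eq_swap) h1]
    refine origin_eq_self fun e h1 h2 h3 => ?_
    by_cases he : (c.get i).1 = e
    · subst he; omega
    · exact h2.separated i he ⟨v, hv, h1⟩ h3
  · rw [origin_eq_other i.2.le hi hvw h1]
    refine (origin_eq_self fun e h1 h2 h3 => ?_).symm
    by_cases he : (c.get i).1 = e
    · subst he; omega
    · rw [countBefore_succ_of_ne c i he] at h3
      exact h2.separated i he ⟨w, hw, h1⟩ h3

/-- The graph formed by the edges that carry a link and are not cancelled. -/
def effectiveGraph (c : LinkConfig H) : SimpleGraph W :=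
  SimpleGraph.fromEdgeSet (Subtype.val '' effectiveEdges c)

theorem effectiveGraph_adj {c : LinkConfig H} (i : Fin c.length)
    (hi : ¬ IsCancelled c (c.get i).1) {v w : W} (hvw : ((c.get i).1 : Sym2 W) = s(v, w)) :
    (effectiveGraph c).Adj v w := by
  refine (SimpleGraph.fromEdgeSet_adj _).2 ⟨⟨(c.get i).1, ⟨?_, hi⟩, hvw⟩, ?_⟩
  · exact List.mem_map.2 ⟨_, List.get_mem c i, rfl⟩
  · have := (c.get i).1.2
    rw [hvw] at this
    exact this.ne

/-- The invariant along loops. Passing a level or a cancelled cross keeps the origin, and any other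
link joins two origins adjacent in `effectiveGraph`. The periodic joining is harmless since every
cancelled edge has count `0` at the bottom and `2` at the top, never `1`. -/
theorem Joined.reachable {c : LinkConfig H} {x y : W × Fin (c.length + 1)} (h : Joined c x y) :
    (effectiveGraph c).Reachable (origin c x.2 x.1) (origin c y.2 y.1) := by
  cases h with
  | periodic v =>
    rw [origin_eq_self, origin_eq_self]
    · intro e _ h
      simp only [Fin.val_last, countBefore_length, h.count]
      norm_num
    · intro e _ _
      simp [countBefore_zero]
  | pass i v hv =>
    simp only [Fin.val_castSucc, Fin.val_succ, origin_pass i hv]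
    exact .rfl
  | cross i v w he hs =>
    simp only [Fin.val_castSucc, Fin.val_succ]
    by_cases hi : IsCancelled c (c.get i).1
    · rw [origin_cross i hi he]
    · rw [(origin_of_not_isCancelled i hi (v := v) (he ▸ Sym2.mem_mk_left v w)).1,
        (origin_of_not_isCancelled i hi (v := w) (he ▸ Sym2.mem_mk_right v w)).2]
      exact (effectiveGraph_adj i hi he).reachable
  | barBelow i v w he hs =>
    have hi : ¬ IsCancelled c (c.get i).1 := fun h => by
      rw [h.cross _ (List.get_mem c i) rfl] at hs; cases hs
    simp only [Fin.val_castSucc]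
    rw [(origin_of_not_isCancelled i hi (v := v) (he ▸ Sym2.mem_mk_left v w)).1,
      (origin_of_not_isCancelled i hi (v := w) (he ▸ Sym2.mem_mk_right v w)).1]
    exact (effectiveGraph_adj i hi he).reachable
  | barAbove i v w he hs =>
    have hi : ¬ IsCancelled c (c.get i).1 := fun h => by
      rw [h.cross _ (List.get_mem c i) rfl] at hs; cases hs
    simp only [Fin.val_succ]
    rw [(origin_of_not_isCancelled i hi (v := v) (he ▸ Sym2.mem_mk_left v w)).2,
      (origin_of_not_isCancelled i hi (v := w) (he ▸ Sym2.mem_mk_right v w)).2]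
    exact (effectiveGraph_adj i hi he).reachable

/-- Vertices on one loop are connected through edges that are not cancelled. -/
theorem LoopConnected.reachable {c : LinkConfig H} {v w : W} (h : LoopConnected c v w) :
    (effectiveGraph c).Reachable v w := by
  obtain ⟨L, h1, h2⟩ := h
  have hq : Relation.EqvGen (Joined c) (v, 0) (w, 0) := Quot.eqvGen_exact (h1.trans h2.symm)
  have key : ∀ x y, Relation.EqvGen (Joined c) x y →
      (effectiveGraph c).Reachable (origin c x.2 x.1) (origin c y.2 y.1) := by
    intro x y hxy
    induction hxy with
    | rel _ _ h => exact h.reachable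
    | refl _ => exact .rfl
    | symm _ _ _ ih => exact ih.symm
    | trans _ _ _ _ _ ih1 ih2 => exact ih1.trans ih2
  have h0 : ∀ v : W, origin c 0 v = v := fun v =>
    origin_eq_self fun e _ _ => by simp [countBefore_zero]
  simpa [h0] using key _ _ hq

/-! ### Cancellation inside one block -/

theorem isCancelled_append {a m b : LinkConfig H} {e : H.edgeSet} (ha : e ∉ a.map Prod.fst)
    (hb : e ∉ b.map Prod.fst) (hm : ∀ l ∈ m, l.1 = e → l.2 = true)
    (hcount : (m.map Prod.fst).count e = 2)
    (hsep : ∀ f ∈ m.map Prod.fst, f ≠ e → ∀ v, v ∈ (f : Sym2 W) → v ∉ (e : Sym2 W)) :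
    IsCancelled (a ++ (m ++ b)) e where
  cross l hl hle := by
    rcases List.mem_append.1 hl with h | h
    · exact absurd (List.mem_map.2 ⟨l, h, hle⟩) ha
    rcases List.mem_append.1 h with h | h
    · exact hm l h hle
    · exact absurd (List.mem_map.2 ⟨l, h, hle⟩) hb
  count := by
    rw [List.map_append, List.map_append, List.count_append, List.count_append, hcount,
      List.count_eq_zero_of_not_mem ha, List.count_eq_zero_of_not_mem hb]
  separated i hi hv := by
    obtain ⟨v, hv1, hv2⟩ := hv
    unfold countBefore
    rw [List.take_append, List.take_append, List.map_append, List.map_append, List.count_append,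
      List.count_append]
    have h1 : ((a.take i).map Prod.fst).count e = 0 :=
      List.count_eq_zero_of_not_mem fun h => ha (((List.take_sublist _ a).map Prod.fst).subset h)
    rw [h1, zero_add]
    rcases lt_or_ge (i : ℕ) a.length with hia | hia
    · have : (i : ℕ) - a.length = 0 := by omega
      simp [this]
    rcases lt_or_ge ((i : ℕ) - a.length) m.length with him | him
    · exfalso
      have hget : (a ++ (m ++ b)).get i = m[(i : ℕ) - a.length] := by
        rw [List.get_eq_getElem, List.getElem_append_right hia, List.getElem_append_left him]
      refine hsep ((a ++ (m ++ b)).get i).1 ?_ hi v hv1 hv2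
      rw [hget]
      exact List.mem_map.2 ⟨_, List.getElem_mem him, rfl⟩
    · rw [List.take_of_length_le him, hcount]
      omega

/-- Two crosses at `e` that form the trace at `e` of a block without links at adjacent edges
cancel, if the other blocks do not contain `e`. -/
theorem isCancelled_flatten {n : ℕ} (cs : Fin n → LinkConfig H) {e : H.edgeSet} (i : Fin n)
    (hne : ∀ j ≠ i, e ∉ (cs j).map Prod.fst) (hm : ∀ l ∈ cs i, l.1 = e → l.2 = true)
    (hcount : ((cs i).map Prod.fst).count e = 2)
    (hsep : ∀ f ∈ (cs i).map Prod.fst, f ≠ e → ∀ v, v ∈ (f : Sym2 W) → v ∉ (e : Sym2 W)) :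
    IsCancelled (List.ofFn cs).flatten e := by
  have hi : (i : ℕ) < (List.ofFn cs).length := by simp
  have hsplit : (List.ofFn cs).flatten = ((List.ofFn cs).take i).flatten
      ++ (cs i ++ ((List.ofFn cs).drop (i + 1)).flatten) := by
    conv_lhs => rw [← List.take_append_drop i (List.ofFn cs), List.drop_eq_getElem_cons hi]
    simp
  rw [hsplit]
  refine isCancelled_append ?_ ?_ hm hcount hsep
  · intro h
    obtain ⟨l, hl, rfl⟩ := List.mem_map.1 h
    obtain ⟨t, ht, hlt⟩ := List.mem_flatten.1 hl
    obtain ⟨j, hj, rfl⟩ := List.mem_take_iff_getElem.1 ht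
    have hj' : j < i := by omega
    rw [List.getElem_ofFn] at hlt
    exact hne _ (fun h => by simp [← h] at hj') (List.mem_map.2 ⟨l, hlt, rfl⟩)
  · intro h
    obtain ⟨l, hl, rfl⟩ := List.mem_map.1 h
    obtain ⟨t, ht, hlt⟩ := List.mem_flatten.1 hl
    obtain ⟨j, hj, rfl⟩ := List.mem_drop_iff_getElem.1 ht
    rw [List.getElem_ofFn] at hlt
    exact hne _ (fun h => by have := congrArg Fin.val h; simp at this; omega)
      (List.mem_map.2 ⟨l, hlt, rfl⟩)

end Cancel

/-! ### Sums with product weights -/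

section ProductSums

theorem tsum_prod_fin {X : Type*} (n : ℕ) (h : Fin n → X → ℝ≥0∞) :
    ∑' x : Fin n → X, ∏ i, h i (x i) = ∏ i, ∑' y, h i y := by
  induction n with
  | zero => simp [tsum_fintype]
  | succ n ih =>
    rw [← (Fin.consEquiv fun _ : Fin (n + 1) => X).tsum_eq, Fin.prod_univ_succ, ← ih,
      ← ENNReal.tsum_mul_right, ENNReal.tsum_prod']
    refine tsum_congr fun y => ?_
    rw [← ENNReal.tsum_mul_left]
    exact tsum_congr fun x => by simp [Fin.prod_univ_succ]

theorem tsum_prod_pi {ι X : Type*} [Fintype ι] (h : ι → X → ℝ≥0∞) :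
    ∑' x : ι → X, ∏ i, h i (x i) = ∏ i, ∑' y, h i y := by
  let e := Fintype.equivFin ι
  rw [← (Equiv.arrowCongr e.symm (Equiv.refl X)).tsum_eq, ← e.symm.prod_comp,
    ← tsum_prod_fin _ fun i => h (e.symm i)]
  refine tsum_congr fun x => ?_
  rw [← e.symm.prod_comp]
  simp

open Classical in
/-- The image of a product weight under a coordinatewise map is a product weight. -/
theorem tsum_prod_map {ι X Y : Type*} [Fintype ι] (A : ι → X → ℝ≥0∞) (φ : ι → X → Y)
    (F : (ι → Y) → ℝ≥0∞) :
    ∑' x : ι → X, (∏ i, A i (x i)) * F (fun i => φ i (x i))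
      = ∑' y : ι → Y, (∏ i, ∑' x, if φ i x = y i then A i x else 0) * F y := by
  have h : ∀ y : ι → Y, (∏ i, ∑' x, if φ i x = y i then A i x else 0) * F y
      = ∑' x : ι → X, (∏ i, if φ i (x i) = y i then A i (x i) else 0) * F y := fun y => by
    rw [← tsum_prod_pi fun i x => if φ i x = y i then A i x else 0, ENNReal.tsum_mul_right]
  rw [tsum_congr h, ENNReal.tsum_comm]
  refine tsum_congr fun x => ?_
  rw [tsum_eq_single fun i => φ i (x i)]
  · simp
  · intro y hy
    obtain ⟨i, hi⟩ := Function.ne_iff.1 hy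
    rw [Finset.prod_eq_zero (Finset.mem_univ i) (if_neg (Ne.symm hi)), zero_mul]

end ProductSums

/-! ### Poisson sequences -/

section Poisson

variable {L : Type*}

/-- The unnormalised weight of a Poisson distribution. -/
def poissonWeight (y : ℝ) (k : ℕ) : ℝ≥0∞ := ENNReal.ofReal (y ^ k / (k.factorial : ℝ))

/-- The weight of a sequence of letters with intensities `b * x l`. -/
def listWeight (b : ℝ) (x : L → ℝ) (c : List L) : ℝ≥0∞ :=
  poissonWeight b c.length * ENNReal.ofReal (c.map x).prod

theorem tsum_poissonWeight {y : ℝ} (hy : 0 ≤ y) :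
    ∑' k, poissonWeight y k = ENNReal.ofReal (Real.exp y) := by
  have h := NormedSpace.expSeries_div_hasSum_exp (𝔸 := ℝ) y
  rw [← Real.exp_eq_exp_ℝ] at h
  unfold poissonWeight
  rw [← ENNReal.ofReal_tsum_of_nonneg (fun n => by positivity) h.summable, h.tsum_eq]

theorem poissonWeight_zero (y : ℝ) : poissonWeight y 0 = 1 := by simp [poissonWeight]

/-- The binomial theorem. -/
theorem sum_poissonWeight_mul {a b : ℝ} (ha : 0 ≤ a) (hb : 0 ≤ b) (n : ℕ) :
    ∑ k : Fin (n + 1), poissonWeight a k * poissonWeight b (n - k) = poissonWeight (a + b) n := by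
  unfold poissonWeight
  rw [← Finset.sum_range fun k => ENNReal.ofReal (a ^ k / (k.factorial : ℝ))
    * ENNReal.ofReal (b ^ (n - k) / ((n - k).factorial : ℝ))]
  have h : ∀ k ∈ Finset.range (n + 1), ENNReal.ofReal (a ^ k / (k.factorial : ℝ))
      * ENNReal.ofReal (b ^ (n - k) / ((n - k).factorial : ℝ))
      = ENNReal.ofReal (a ^ k * b ^ (n - k) * (n.choose k) / (n.factorial : ℝ)) := by
    intro k hk
    rw [← ENNReal.ofReal_mul (by positivity)]
    congr 1
    have hk' : k ≤ n := Nat.lt_succ_iff.1 (Finset.mem_range.1 hk)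
    rw [Nat.cast_choose ℝ hk']
    have := Nat.factorial_ne_zero n
    field_simp
  rw [Finset.sum_congr rfl h, ← ENNReal.ofReal_sum_of_nonneg fun k _ => by positivity,
    ← Finset.sum_div, ← add_pow]

theorem listWeight_append {a b : ℝ} (x : L → ℝ) (hx : ∀ l, 0 ≤ x l) (c d : List L) :
    listWeight a x c * listWeight b x d
      = poissonWeight a c.length * poissonWeight b d.length
        * ENNReal.ofReal ((c ++ d).map x).prod := by
  unfold listWeight
  rw [List.map_append, List.prod_append, ENNReal.ofReal_mul]
  · ring
  · exact List.prod_nonneg fun y hy => by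
      obtain ⟨l, _, rfl⟩ := List.mem_map.1 hy
      exact hx l

/-- The splittings of a list into two parts. -/
def splitEquiv (c : List L) : {p : List L × List L // p.1 ++ p.2 = c} ≃ Fin (c.length + 1) where
  toFun p := ⟨p.1.1.length, by
    have := congrArg List.length p.2
    rw [List.length_append] at this
    omega⟩
  invFun k := ⟨(c.take k, c.drop k), List.take_append_drop k c⟩
  left_inv := by
    rintro ⟨⟨a, d⟩, rfl⟩
    simp
  right_inv k := by
    ext
    simpa using Nat.lt_succ_iff.1 k.2

/-- Concatenating independent Poisson sequences adds their rates. -/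
theorem tsum_listWeight_append {a b : ℝ} (ha : 0 ≤ a) (hb : 0 ≤ b) (x : L → ℝ)
    (hx : ∀ l, 0 ≤ x l) (F : List L → ℝ≥0∞) :
    ∑' c, ∑' d, listWeight a x c * listWeight b x d * F (c ++ d)
      = ∑' c, listWeight (a + b) x c * F c := by
  rw [← ENNReal.tsum_prod, ← (Equiv.sigmaFiberEquiv fun p : List L × List L => p.1 ++ p.2).tsum_eq,
    ENNReal.tsum_sigma']
  refine tsum_congr fun c => ?_
  rw [← (splitEquiv c).symm.tsum_eq, tsum_fintype, listWeight, ← sum_poissonWeight_mul ha hb,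
    Finset.sum_mul, Finset.sum_mul]
  refine Finset.sum_congr rfl fun k _ => ?_
  have hk : (k : ℕ) ≤ c.length := Nat.lt_succ_iff.1 k.2
  simp only [Equiv.sigmaFiberEquiv, Equiv.coe_fn_mk, splitEquiv, Equiv.coe_fn_symm_mk]
  rw [listWeight_append x hx, List.take_append_drop, List.length_take, List.length_drop,
    min_eq_left hk]

/-- This cuts time into slots: a uniformly ordered Poisson sequence has the law of independent ones
written one after another. -/
theorem tsum_listWeight_flatten {n : ℕ} (b : Fin n → ℝ) (hb : ∀ i, 0 ≤ b i) (x : L → ℝ)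
    (hx : ∀ l, 0 ≤ x l) (F : List L → ℝ≥0∞) :
    ∑' cs : Fin n → List L, (∏ i, listWeight (b i) x (cs i)) * F (List.ofFn cs).flatten
      = ∑' c, listWeight (∑ i, b i) x c * F c := by
  induction n generalizing F with
  | zero =>
    rw [tsum_fintype, Fintype.sum_unique, tsum_eq_single []]
    · simp [listWeight, poissonWeight]
    · intro c hc
      have : c.length ≠ 0 := fun h => hc (List.length_eq_zero_iff.1 h)
      simp [listWeight, poissonWeight, this]
  | succ n ih =>
    rw [← (Fin.consEquiv fun _ : Fin (n + 1) => List L).tsum_eq, ENNReal.tsum_prod',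
      Fin.sum_univ_succ, ← tsum_listWeight_append (hb 0) (Finset.sum_nonneg fun i _ => hb _) x hx]
    refine tsum_congr fun c => ?_
    have := ih (fun i => b i.succ) (fun i => hb _) fun d => F (c ++ d)
    simp only [mul_assoc, ENNReal.tsum_mul_left]
    rw [← this, ← ENNReal.tsum_mul_left]
    refine tsum_congr fun cs => ?_
    simp [Fin.prod_univ_succ, mul_assoc]

theorem prod_single {ι M R : Type*} [AddCommMonoid M] [CommSemiring R] (s : Finset ι) (g : ι → M)
    (r : ι → R) : ∏ i ∈ s, AddMonoidAlgebra.single (g i) (r i)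
      = AddMonoidAlgebra.single (∑ i ∈ s, g i) (∏ i ∈ s, r i) := by
  classical
  induction s using Finset.induction_on with
  | empty => rfl
  | insert i s hi ih =>
    rw [Finset.prod_insert hi, Finset.sum_insert hi, Finset.prod_insert hi, ih,
      AddMonoidAlgebra.single_mul_single]

theorem count_ofFn [DecidableEq L] {n : ℕ} (f : Fin n → L) (l : L) :
    (List.ofFn f).count l = ∑ i, (Pi.single (f i) 1 : L → ℕ) l := by
  induction n with
  | zero => simp
  | succ n ih =>
    rw [List.ofFn_succ, List.count_cons, ih, Fin.sum_univ_succ, add_comm, Pi.single_apply]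
    by_cases h : f 0 = l
    · simp [h]
    · simp [h, Ne.symm h]

variable [Fintype L]

/-- The multinomial theorem in a monoid algebra whose exponents record the letter counts, so that an
arbitrary function of the counts can be applied to both expansions. -/
theorem sum_prod_count [DecidableEq L] (n : ℕ) (y : L → ℝ≥0∞) (G : (L → ℕ) → ℝ≥0∞) :
    ∑ f : Fin n → L, (∏ i, y (f i)) * G (fun l => (List.ofFn f).count l)
      = ∑ k ∈ (Finset.univ : Finset L).piAntidiag n,
          (Nat.multinomial Finset.univ k : ℝ≥0∞) * (∏ l, y l ^ k l) * G k := by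
  -- Replaces the monomial with exponent `k` by the number `G k`.
  let Φ : AddMonoidAlgebra ℝ≥0∞ (L → ℕ) →+ ℝ≥0∞ :=
    AddMonoidAlgebra.liftNC (AddMonoidHom.id _) fun k => G k.toAdd
  have hΦ : ∀ k r, Φ (AddMonoidAlgebra.single k r) = r * G k := fun k r => by
    simp [Φ, AddMonoidAlgebra.liftNC_single]
  let z : L → AddMonoidAlgebra ℝ≥0∞ (L → ℕ) := fun l =>
    AddMonoidAlgebra.single (Pi.single l 1) (y l)
  have key := congrArg Φ ((Fintype.sum_pow z n).symm.trans
    (Finset.sum_pow_eq_sum_piAntidiag Finset.univ z n))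
  rw [map_sum, map_sum] at key
  refine Eq.trans ?_ (key.trans ?_)
  · refine Finset.sum_congr rfl fun f _ => ?_
    rw [prod_single, hΦ]
    congr 2
    funext l
    rw [Finset.sum_apply]
    exact count_ofFn f l
  · refine Finset.sum_congr rfl fun k _ => ?_
    have h1 : ∏ l, z l ^ k l = AddMonoidAlgebra.single k (∏ l, y l ^ k l) := by
      simp only [z, AddMonoidAlgebra.single_pow]
      rw [prod_single]
      congr 1
      funext l
      simp [Finset.sum_apply, Pi.single_apply]
    rw [h1, ← nsmul_eq_mul, map_nsmul, hΦ, nsmul_eq_mul, mul_assoc]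

theorem poissonWeight_mul_multinomial {b : ℝ} (hb : 0 ≤ b) (x : L → ℝ) (hx : ∀ l, 0 ≤ x l)
    (k : L → ℕ) : poissonWeight b (∑ l, k l)
        * ((Nat.multinomial Finset.univ k : ℝ≥0∞) * ∏ l, ENNReal.ofReal (x l) ^ k l)
      = ∏ l, poissonWeight (b * x l) (k l) := by
  unfold poissonWeight
  rw [← ENNReal.ofReal_natCast]
  simp only [← ENNReal.ofReal_pow (hx _)]
  rw [← ENNReal.ofReal_prod_of_nonneg fun l _ => pow_nonneg (hx l) _,
    ← ENNReal.ofReal_mul (by positivity), ← ENNReal.ofReal_mul (by positivity),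
    ← ENNReal.ofReal_prod_of_nonneg fun l _ =>
      div_nonneg (pow_nonneg (mul_nonneg hb (hx l)) _) (by positivity)]
  congr 1
  simp only [mul_pow, Finset.prod_div_distrib, Finset.prod_mul_distrib]
  rw [Finset.prod_pow_eq_pow_sum, ← Nat.multinomial_spec Finset.univ k]
  push_cast
  have h1 : (∏ l, ((k l).factorial : ℝ)) ≠ 0 :=
    Finset.prod_ne_zero_iff.2 fun l _ => by exact_mod_cast Nat.factorial_ne_zero _
  have h2 : (Nat.multinomial Finset.univ k : ℝ) ≠ 0 := by
    exact_mod_cast (Nat.multinomial_pos Finset.univ k).ne'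
  field_simp

/-- The letter counts of a Poisson sequence are independent Poisson variables. -/
theorem tsum_listWeight_count [DecidableEq L] {b : ℝ} (hb : 0 ≤ b) (x : L → ℝ) (hx : ∀ l, 0 ≤ x l)
    (G : (L → ℕ) → ℝ≥0∞) :
    ∑' c, listWeight b x c * G (fun l => c.count l)
      = ∑' k : L → ℕ, (∏ l, poissonWeight (b * x l) (k l)) * G k := by
  rw [← (List.equivSigmaTuple (α := L)).symm.tsum_eq, ENNReal.tsum_sigma']
  have h1 : ∀ n : ℕ, ∑' f : Fin n → L, listWeight b x (List.equivSigmaTuple.symm ⟨n, f⟩)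
        * G (fun l => (List.equivSigmaTuple.symm ⟨n, f⟩).count l)
      = ∑' k : L → ℕ, if ∑ l, k l = n then (∏ l, poissonWeight (b * x l) (k l)) * G k else 0 := by
    intro n
    simp only [List.equivSigmaTuple, Equiv.coe_fn_symm_mk, listWeight, List.length_ofFn]
    rw [tsum_fintype]
    have h2 : ∀ f : Fin n → L, poissonWeight b n * ENNReal.ofReal ((List.ofFn f).map x).prod
          * G (fun l => (List.ofFn f).count l)
        = poissonWeight b n * ((∏ i, ENNReal.ofReal (x (f i)))
          * G (fun l => (List.ofFn f).count l)) := by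
      intro f
      rw [List.map_ofFn, List.prod_ofFn]
      simp only [Function.comp_apply]
      rw [ENNReal.ofReal_prod_of_nonneg fun i _ => hx _, mul_assoc]
    rw [Finset.sum_congr rfl fun f _ => h2 f, ← Finset.mul_sum,
      sum_prod_count n fun l => ENNReal.ofReal (x l), Finset.mul_sum,
      tsum_eq_sum (s := (Finset.univ : Finset L).piAntidiag n)]
    · refine Finset.sum_congr rfl fun k hk => ?_
      have hk' : ∑ l, k l = n := (Finset.mem_piAntidiag.1 hk).1
      rw [if_pos hk', ← poissonWeight_mul_multinomial hb x hx, hk', ← mul_assoc]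
    · intro k hk
      refine if_neg fun h => hk (Finset.mem_piAntidiag.2 ⟨h, fun _ _ => Finset.mem_univ _⟩)
  rw [tsum_congr h1, ENNReal.tsum_comm]
  refine tsum_congr fun k => ?_
  rw [tsum_eq_single (∑ l, k l) fun n hn => if_neg (Ne.symm hn), if_pos rfl]

end Poisson

/-! ### The law of the edge states -/

section States

variable {E : Type*}

/-- The type weights: a link is a cross with probability `u`. -/
def typeWeight (u : ℝ) (t : Bool) : ℝ := if t then u else 1 - u

theorem typeWeight_nonneg {u : ℝ} (hu : u ∈ Set.Icc (0 : ℝ) 1) (t : Bool) :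
    0 ≤ typeWeight u t := by
  unfold typeWeight
  split_ifs
  · exact hu.1
  · linarith [hu.2]

/-- The weight of the link counts at one edge, by time slot and link type. -/
def slotWeight {n : ℕ} (b : Fin n → ℝ) (u : ℝ) (κ : Fin n → Bool → ℕ) : ℝ≥0∞ :=
  ∏ i, ∏ t, poissonWeight (b i * typeWeight u t) (κ i t)

theorem tsum_ite_listWeight [Fintype E] [DecidableEq E] {b : ℝ} (hb : 0 ≤ b) (x : E → ℝ)
    (hx : ∀ l, 0 ≤ x l) (k : E → ℕ) [∀ c : List E, Decidable ((fun l => c.count l) = k)] :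
    (∑' c : List E, if (fun l => c.count l) = k then listWeight b x c else 0)
      = ∏ l, poissonWeight (b * x l) (k l) := by
  classical
  have h := tsum_listWeight_count hb x hx fun k' => if k' = k then 1 else 0
  rw [tsum_eq_single (f := fun k' : E → ℕ => _) k fun k' hk' => by rw [if_neg hk', mul_zero],
    if_pos rfl, mul_one] at h
  rw [← h]
  refine tsum_congr fun c => ?_
  split_ifs <;> simp

/-- Regrouping counts by edge instead of by slot. -/
def regroup (E : Type*) (n : ℕ) : (Fin n → E × Bool → ℕ) ≃ (E → Fin n → Bool → ℕ) where
  toFun k e i t := k i (e, t)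
  invFun κ i l := κ l.1 i l.2
  left_inv _ := rfl
  right_inv _ := rfl

open Classical in
/-- Functions of the link counts at the single edges are independent. -/
theorem tsum_listWeight_states [Fintype E] [DecidableEq E] {S : Type*} {n : ℕ} {b : Fin n → ℝ}
    (hb : ∀ i, 0 ≤ b i)
    {u : ℝ} (hu : u ∈ Set.Icc (0 : ℝ) 1) (st : E → (Fin n → Bool → ℕ) → S)
    (F : (E → S) → ℝ≥0∞) :
    ∑' cs : Fin n → List (E × Bool), (∏ i, listWeight (b i) (fun l => typeWeight u l.2) (cs i))
        * F (fun e => st e fun i t => (cs i).count (e, t))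
      = ∑' σ : E → S, (∏ e, ∑' κ, if st e κ = σ e then slotWeight b u κ else 0) * F σ := by
  rw [← tsum_prod_map (fun _ => slotWeight b u) st F, ← (regroup E n).tsum_eq]
  refine (tsum_prod_map (fun i => listWeight (b i) fun l : E × Bool => typeWeight u l.2)
    (fun _ c l => c.count l) fun k => F fun e => st e fun i t => k i (e, t)).trans ?_
  refine tsum_congr fun k => ?_
  congr 1
  unfold slotWeight
  rw [Finset.prod_comm]
  refine Finset.prod_congr rfl fun i _ => ?_
  refine Eq.trans (b := ∏ l : E × Bool, poissonWeight (b i * typeWeight u l.2) (k i l)) ?_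
    (Fintype.prod_prod_type _)
  convert tsum_ite_listWeight (hb i) (fun l : E × Bool => typeWeight u l.2)
    (fun l => typeWeight_nonneg hu _) (k i)

/-- The state of an edge in terms of its links: no link; two crosses in the slot reserved for the
edge and nothing else; links in the last slot only; anything else. -/
inductive EdgeState
  | closed
  | crossed
  | late
  | mixed
  deriving DecidableEq

instance : Fintype EdgeState :=
  ⟨{.closed, .crossed, .late, .mixed}, fun s => by cases s <;> simp⟩

/-- Two crosses in the slot `i`. -/
def crossPair {n : ℕ} (i : Fin n) : Fin n → Bool → ℕ := fun j t => if j = i ∧ t then 2 else 0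

open Classical in
/-- The state of an edge with reserved slot `i`. -/
def edgeState {C : ℕ} (i : Fin C) (κ : Fin (C + 1) → Bool → ℕ) : EdgeState :=
  if κ = 0 then .closed else if κ = crossPair i.castSucc then .crossed
  else if ∀ j : Fin C, κ j.castSucc = 0 then .late else .mixed

theorem crossPair_ne_zero {n : ℕ} (i : Fin n) : crossPair i ≠ 0 := fun h => by
  have := congrFun (congrFun h i) true
  simp [crossPair] at this

theorem edgeState_eq_closed {C : ℕ} {i : Fin C} {κ : Fin (C + 1) → Bool → ℕ} :
    edgeState i κ = .closed ↔ κ = 0 := by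
  unfold edgeState
  split_ifs <;> simp_all

theorem edgeState_eq_crossed {C : ℕ} {i : Fin C} {κ : Fin (C + 1) → Bool → ℕ} :
    edgeState i κ = .crossed ↔ κ = crossPair i.castSucc := by
  unfold edgeState
  have := crossPair_ne_zero i.castSucc
  split_ifs <;> simp_all [eq_comm]

theorem edgeState_closed_or_late {C : ℕ} {i : Fin C} {κ : Fin (C + 1) → Bool → ℕ} :
    (edgeState i κ = .closed ∨ edgeState i κ = .late) ↔ ∀ j : Fin C, κ j.castSucc = 0 := by
  unfold edgeState
  split_ifs with h1 h2 h3
  · subst h1; simp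
  · subst h2
    simp only [or_self, false_iff]
    intro h
    have := congrFun (h i) true
    simp [crossPair] at this
  · simpa using h3
  · simpa using h3

/-- The weight of a state. -/
def stateWeight {C : ℕ} (b : Fin (C + 1) → ℝ) (u : ℝ) (i : Fin C) (s : EdgeState) : ℝ≥0∞ :=
  ∑' κ, if edgeState i κ = s then slotWeight b u κ else 0

theorem tsum_prod_typeWeight {b u : ℝ} (hb : 0 ≤ b) (hu : u ∈ Set.Icc (0 : ℝ) 1) :
    ∑' v : Bool → ℕ, ∏ t, poissonWeight (b * typeWeight u t) (v t)
      = ENNReal.ofReal (Real.exp b) := by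
  rw [tsum_prod_pi fun t k => poissonWeight (b * typeWeight u t) k, Fintype.prod_bool,
    tsum_poissonWeight (mul_nonneg hb (typeWeight_nonneg hu _)),
    tsum_poissonWeight (mul_nonneg hb (typeWeight_nonneg hu _)),
    ← ENNReal.ofReal_mul (Real.exp_pos _).le, ← Real.exp_add]
  congr 2
  simp only [typeWeight, if_true, Bool.false_eq_true, if_false]
  ring

variable {C : ℕ} {b : Fin (C + 1) → ℝ} {u : ℝ} {i : Fin C}

theorem stateWeight_closed : stateWeight b u i .closed = 1 := by
  unfold stateWeight
  rw [tsum_eq_single 0]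
  · rw [if_pos (edgeState_eq_closed.2 rfl)]
    simp [slotWeight, poissonWeight_zero]
  · intro κ hκ
    rw [if_neg fun h => hκ (edgeState_eq_closed.1 h)]

theorem stateWeight_crossed :
    stateWeight b u i .crossed = ENNReal.ofReal ((b i.castSucc * u) ^ 2 / 2) := by
  unfold stateWeight
  rw [tsum_eq_single (crossPair i.castSucc)]
  · rw [if_pos (edgeState_eq_crossed.2 rfl), slotWeight, Finset.prod_eq_single i.castSucc]
    · simp [crossPair, poissonWeight, typeWeight]
    · intro j _ hj
      simp [crossPair, hj, poissonWeight_zero]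
    · simp
  · intro κ hκ
    rw [if_neg fun h => hκ (edgeState_eq_crossed.1 h)]

theorem sum_stateWeight (hb : ∀ j, 0 ≤ b j) (hu : u ∈ Set.Icc (0 : ℝ) 1) :
    ∑ s, stateWeight b u i s = ENNReal.ofReal (Real.exp (∑ j, b j)) := by
  unfold stateWeight
  rw [← Summable.tsum_finsetSum fun _ _ => ENNReal.summable]
  simp only [Finset.sum_ite_eq, Finset.mem_univ, if_true]
  unfold slotWeight
  rw [tsum_prod_pi fun j (v : Bool → ℕ) => ∏ t, poissonWeight (b j * typeWeight u t) (v t),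
    Real.exp_sum,
    ENNReal.ofReal_prod_of_nonneg fun j _ => (Real.exp_pos _).le]
  exact Finset.prod_congr rfl fun j _ => tsum_prod_typeWeight (hb j) hu

-- Together these states leave the last slot free and every other slot empty, a product condition;
-- the weight of `late` alone follows by subtraction.
open Classical in
theorem stateWeight_closed_add_late (hb : ∀ j, 0 ≤ b j) (hu : u ∈ Set.Icc (0 : ℝ) 1) :
    stateWeight b u i .closed + stateWeight b u i .late
      = ENNReal.ofReal (Real.exp (b (Fin.last C))) := by
  unfold stateWeight
  rw [← ENNReal.tsum_add]
  have h : ∀ κ : Fin (C + 1) → Bool → ℕ,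
      ((if edgeState i κ = .closed then slotWeight b u κ else 0)
        + if edgeState i κ = .late then slotWeight b u κ else 0)
      = ∏ j, (if j = Fin.last C ∨ κ j = 0
          then ∏ t, poissonWeight (b j * typeWeight u t) (κ j t) else 0) := by
    intro κ
    have h1 : (∀ j, j = Fin.last C ∨ κ j = 0) ↔ ∀ j : Fin C, κ j.castSucc = 0 := by
      rw [Fin.forall_fin_succ']
      simp [Fin.castSucc_ne_last]
    have h2 := edgeState_closed_or_late (i := i) (κ := κ)
    rw [← h1] at h2
    by_cases h3 : ∀ j, j = Fin.last C ∨ κ j = 0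
    · rw [Finset.prod_congr rfl fun j _ => if_pos (h3 j)]
      rcases h2.2 h3 with h4 | h4 <;> simp [h4, slotWeight]
    · have h4 := not_or.1 (mt h2.1 h3)
      rw [if_neg h4.1, if_neg h4.2, add_zero]
      obtain ⟨j, hj⟩ := not_forall.1 h3
      exact (Finset.prod_eq_zero (Finset.mem_univ j) (if_neg hj)).symm
  rw [tsum_congr h, tsum_prod_pi fun j (v : Bool → ℕ) => if j = Fin.last C ∨ v = 0
          then ∏ t, poissonWeight (b j * typeWeight u t) (v t) else 0, Fin.prod_univ_castSucc]
  simp only [true_or, if_true, tsum_prod_typeWeight (hb _) hu, Fin.castSucc_ne_last, false_or]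
  rw [Finset.prod_eq_one, one_mul]
  intro j _
  rw [tsum_eq_single 0 fun v hv => if_neg hv]
  simp [poissonWeight_zero]

end States

/-! ### Edge states from independent bits -/

section Bits

/-- The probability of a value of a Bernoulli variable. -/
def bitWeight (p : ℝ) (x : Bool) : ℝ := if x then p else 1 - p

theorem bitWeight_nonneg {p : ℝ} (h0 : 0 ≤ p) (h1 : p ≤ 1) (x : Bool) : 0 ≤ bitWeight p x :=
  typeWeight_nonneg ⟨h0, h1⟩ x

/-- The joint weight of three independent bits. -/
def bitsWeight (a r s : ℝ) (x : Bool × Bool × Bool) : ℝ :=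
  bitWeight a x.1 * (bitWeight r x.2.1 * bitWeight s x.2.2)

/-- The state encoded by three bits. -/
def stateOfBits : Bool × Bool × Bool → EdgeState
  -- The two remaining bits exist for closed edges too, although they do not affect the state; this
  -- is what makes the core independent of the open edges.
  | (false, _, _) => .closed
  | (true, false, _) => .mixed
  | (true, true, true) => .crossed
  | (true, true, false) => .late

variable {E : Type*} [Fintype E] [DecidableEq E]

theorem sum_bitWeight (p : ℝ) (g : Finset E → ℝ) :
    ∑ x : E → Bool, (∏ e, bitWeight p (x e)) * g (Finset.univ.filter fun e => x e)
      = bernoulliSum p Finset.univ g := by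
  unfold bernoulliSum
  rw [Finset.powerset_univ]
  refine Finset.sum_bij' (fun x _ => Finset.univ.filter fun e => x e) (fun D _ e => decide (e ∈ D))
    (by simp) (by simp) (fun x _ => by ext; simp) (fun D _ => by ext; simp) fun x _ => ?_
  congr 1
  simp only [bitWeight]
  rw [Finset.prod_ite, Finset.prod_const, Finset.prod_const]
  congr 3
  ext; simp

theorem sum_bitsWeight (a r s : ℝ) (f : Finset E → Finset E → Finset E → ℝ) :
    ∑ x : E → Bool × Bool × Bool, (∏ e, bitsWeight a r s (x e))
        * f (Finset.univ.filter fun e => (x e).1) (Finset.univ.filter fun e => (x e).2.1)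
          (Finset.univ.filter fun e => (x e).2.2)
      = bernoulliSum a Finset.univ fun O => bernoulliSum r Finset.univ fun P =>
          bernoulliSum s Finset.univ fun X => f O P X := by
  simp only [← sum_bitWeight]
  rw [← (Equiv.arrowProdEquivProdArrow E (fun _ => Bool) fun _ => Bool × Bool).symm.sum_comp,
    Fintype.sum_prod_type]
  refine Finset.sum_congr rfl fun x _ => ?_
  rw [← (Equiv.arrowProdEquivProdArrow E (fun _ => Bool) fun _ => Bool).symm.sum_comp,
    Fintype.sum_prod_type, Finset.mul_sum]
  refine Finset.sum_congr rfl fun y _ => ?_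
  rw [Finset.mul_sum, Finset.mul_sum]
  refine Finset.sum_congr rfl fun z _ => ?_
  simp only [bitsWeight, Equiv.arrowProdEquivProdArrow, Equiv.coe_fn_symm_mk,
    Finset.prod_mul_distrib, mul_assoc]
  rfl

variable {C : ℕ} {b : Fin (C + 1) → ℝ} {u : ℝ} {i : Fin C}

/-- The equations `h1`, `h2`, `h3` match the masses of `closed`, `crossed` and `late`; `mixed` is
then matched because the total masses agree. -/
theorem stateWeight_eq_sum_bits (hb : ∀ j, 0 ≤ b j) (hu : u ∈ Set.Icc (0 : ℝ) 1) {a r s : ℝ}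
    (ha0 : 0 ≤ a) (ha1 : a ≤ 1) (hr0 : 0 ≤ r) (hr1 : r ≤ 1) (hs0 : 0 ≤ s) (hs1 : s ≤ 1)
    (h1 : Real.exp (∑ j, b j) * (1 - a) = 1)
    (h2 : Real.exp (∑ j, b j) * (a * (r * s)) = (b i.castSucc * u) ^ 2 / 2)
    (h3 : Real.exp (∑ j, b j) * (a * (r * (1 - s))) = Real.exp (b (Fin.last C)) - 1)
    (σ : EdgeState) :
    stateWeight b u i σ = ∑ x, if stateOfBits x = σ
      then ENNReal.ofReal (Real.exp (∑ j, b j)) * ENNReal.ofReal (bitsWeight a r s x) else 0 := by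
  have hZ := (Real.exp_pos (∑ j, b j)).le
  have h1a : 0 ≤ 1 - a := by linarith
  have h1r : 0 ≤ 1 - r := by linarith
  have h1s : 0 ≤ 1 - s := by linarith
  have hx : ∀ x, ENNReal.ofReal (Real.exp (∑ j, b j)) * ENNReal.ofReal (bitsWeight a r s x)
      = ENNReal.ofReal (Real.exp (∑ j, b j) * bitsWeight a r s x) := fun x =>
    (ENNReal.ofReal_mul hZ).symm
  have hx0 : ∀ x, 0 ≤ Real.exp (∑ j, b j) * bitsWeight a r s x := fun x =>
    mul_nonneg hZ (mul_nonneg (bitWeight_nonneg ha0 ha1 _)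
      (mul_nonneg (bitWeight_nonneg hr0 hr1 _) (bitWeight_nonneg hs0 hs1 _)))
  have hite : ∀ σ : EdgeState, (∑ x, if stateOfBits x = σ then ENNReal.ofReal (Real.exp (∑ j, b j))
        * ENNReal.ofReal (bitsWeight a r s x) else 0)
      = ENNReal.ofReal (∑ x, if stateOfBits x = σ
          then Real.exp (∑ j, b j) * bitsWeight a r s x else 0) := fun σ => by
    rw [ENNReal.ofReal_sum_of_nonneg fun x _ => by split_ifs; exacts [hx0 x, le_rfl]]
    refine Finset.sum_congr rfl fun x _ => ?_
    rw [hx]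
    split_ifs <;> simp
  have hlate : stateWeight b u i .late = ENNReal.ofReal (Real.exp (b (Fin.last C)) - 1) := by
    have := stateWeight_closed_add_late (i := i) hb hu
    rw [stateWeight_closed] at this
    rw [ENNReal.ofReal_sub _ zero_le_one, ← this, ENNReal.ofReal_one,
      ENNReal.add_sub_cancel_left ENNReal.one_ne_top]
  have hsumx : ∀ g : Bool × Bool × Bool → ℝ, ∑ x, g x = g (true, true, true) + g (true, true, false)
      + (g (true, false, true) + g (true, false, false))
      + (g (false, true, true) + g (false, true, false)
      + (g (false, false, true) + g (false, false, false))) := fun g => by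
    simp [Fintype.sum_prod_type]
  rw [hite, hsumx]
  cases σ with
  | closed =>
    rw [stateWeight_closed, ← ENNReal.ofReal_one]
    congr 1
    simp only [stateOfBits, bitsWeight, bitWeight, if_true, if_false, reduceCtorEq,
      Bool.false_eq_true]
    linear_combination -h1
  | crossed =>
    rw [stateWeight_crossed]
    congr 1
    simp only [stateOfBits, bitsWeight, bitWeight, if_true, if_false, reduceCtorEq,
      Bool.false_eq_true]
    linear_combination -h2
  | late =>
    rw [hlate]
    congr 1
    simp only [stateOfBits, bitsWeight, bitWeight, if_true, if_false, reduceCtorEq,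
      Bool.false_eq_true]
    linear_combination -h3
  | mixed =>
    have htot := sum_stateWeight (i := i) hb hu
    have hfin : ENNReal.ofReal 1 + ENNReal.ofReal ((b i.castSucc * u) ^ 2 / 2)
        + ENNReal.ofReal (Real.exp (b (Fin.last C)) - 1) ≠ ∞ := by finiteness
    have hlist : ∀ g : EdgeState → ℝ≥0∞,
        ∑ σ, g σ = g .closed + g .crossed + g .late + g .mixed := fun g => by
      have : (Finset.univ : Finset EdgeState) = {.closed, .crossed, .late, .mixed} := rfl
      rw [this]
      simp [add_assoc]
    rw [hlist, stateWeight_closed, stateWeight_crossed, hlate, ← ENNReal.ofReal_one] at htot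
    refine (ENNReal.add_right_inj hfin).1 (htot.trans ?_)
    have h0 : 0 ≤ Real.exp (b (Fin.last C)) - 1 := by
      linarith [Real.add_one_le_exp (b (Fin.last C)), hb (Fin.last C)]
    have g1 := hx0 (true, false, true)
    have g2 := hx0 (true, false, false)
    simp only [stateOfBits, if_true, if_false, reduceCtorEq, add_zero, zero_add]
    rw [← ENNReal.ofReal_add zero_le_one (by positivity), ← ENNReal.ofReal_add (by positivity) h0,
      ← ENNReal.ofReal_add (by positivity) (by positivity)]
    congr 1
    simp only [bitsWeight, bitWeight, if_true, if_false, Bool.false_eq_true]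
    linear_combination h1 + h2 + h3

open Classical in
/-- The edge states of independent Poisson sequences, expressed through independent bits. -/
theorem tsum_listWeight_bits (hb : ∀ j, 0 ≤ b j) (hu : u ∈ Set.Icc (0 : ℝ) 1) {a r s : ℝ}
    (ha0 : 0 ≤ a) (ha1 : a ≤ 1) (hr0 : 0 ≤ r) (hr1 : r ≤ 1) (hs0 : 0 ≤ s) (hs1 : s ≤ 1)
    (slot : E → Fin C)
    (h1 : Real.exp (∑ j, b j) * (1 - a) = 1)
    (h2 : ∀ i : Fin C, Real.exp (∑ j, b j) * (a * (r * s)) = (b i.castSucc * u) ^ 2 / 2)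
    (h3 : Real.exp (∑ j, b j) * (a * (r * (1 - s))) = Real.exp (b (Fin.last C)) - 1)
    (F : (E → EdgeState) → ℝ) (hF : ∀ σ, 0 ≤ F σ) :
    ∑' cs : Fin (C + 1) → List (E × Bool),
        (∏ j, listWeight (b j) (fun l => typeWeight u l.2) (cs j))
        * ENNReal.ofReal (F (fun e => edgeState (slot e) fun j t => (cs j).count (e, t)))
      = ENNReal.ofReal (Real.exp (∑ j, b j)) ^ Fintype.card E
        * ENNReal.ofReal (∑ x : E → Bool × Bool × Bool, (∏ e, bitsWeight a r s (x e))
          * F (fun e => stateOfBits (x e))) := by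
  refine (tsum_listWeight_states hb hu (fun e => edgeState (slot e))
    fun σ => ENNReal.ofReal (F σ)).trans ?_
  have hbw : ∀ x, 0 ≤ bitsWeight a r s x := fun x =>
    mul_nonneg (bitWeight_nonneg ha0 ha1 _)
      (mul_nonneg (bitWeight_nonneg hr0 hr1 _) (bitWeight_nonneg hs0 hs1 _))
  have key := tsum_prod_map (ι := E)
    (fun _ x => ENNReal.ofReal (Real.exp (∑ j, b j)) * ENNReal.ofReal (bitsWeight a r s x))
    (fun _ => stateOfBits) fun σ => ENNReal.ofReal (F σ)
  rw [ENNReal.ofReal_sum_of_nonneg fun x _ =>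
    mul_nonneg (Finset.prod_nonneg fun e _ => hbw _) (hF _), Finset.mul_sum]
  rw [tsum_fintype] at key
  refine Eq.trans ?_ (key.symm.trans ?_)
  · refine tsum_congr fun σ => ?_
    congr 1
    refine Finset.prod_congr rfl fun e _ => ?_
    refine Eq.trans (b := stateWeight b u (slot e) (σ e)) (tsum_congr fun κ => by congr)
      ((stateWeight_eq_sum_bits hb hu ha0 ha1 hr0 hr1 hs0 hs1 h1 (h2 (slot e)) h3 (σ e)).trans ?_)
    rw [tsum_fintype]
    exact Finset.sum_congr rfl fun x _ => by congr
  · refine Finset.sum_congr rfl fun x _ => ?_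
    rw [Finset.prod_mul_distrib, Finset.prod_const, Finset.card_univ,
      ENNReal.ofReal_mul (Finset.prod_nonneg fun e _ => hbw _),
      ENNReal.ofReal_prod_of_nonneg fun e _ => hbw _, mul_assoc]

end Bits

/-! ### Comparison of the loop measure with a Bernoulli field -/

section Comparison

variable {W : Type*} {H : SimpleGraph W} [DecidableEq H.edgeSet]

theorem count_map_fst (c : LinkConfig H) (e : H.edgeSet) :
    (c.map Prod.fst).count e = c.count (e, true) + c.count (e, false) := by
  induction c with
  | nil => simp
  | cons l c ih =>
    rw [List.map_cons, List.count_cons, List.count_cons, List.count_cons, ih]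
    obtain ⟨f, t⟩ := l
    cases t <;> simp <;> ring

theorem mem_map_fst_iff (c : LinkConfig H) (e : H.edgeSet) :
    e ∈ c.map Prod.fst ↔ ∃ t, c.count (e, t) ≠ 0 := by
  rw [← List.count_pos_iff, count_map_fst, Bool.exists_bool]
  omega

/-- The link counts of a slotted configuration at one edge. -/
def slotCounts {n : ℕ} (cs : Fin n → LinkConfig H) (e : H.edgeSet) : Fin n → Bool → ℕ :=
  fun j t => (cs j).count (e, t)

/-- The slot of `e` contains no link of an adjacent edge `f`: if `f` is crossed, its links are in
another slot by properness; if late, in the last slot; if closed, nowhere. -/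
theorem isCancelled_of_edgeState {C : ℕ} (slot : H.edgeSet → Fin C)
    (hslot : ∀ e f : H.edgeSet, e ≠ f → (∃ v, v ∈ (e : Sym2 W) ∧ v ∈ (f : Sym2 W)) →
      slot e ≠ slot f) (cs : Fin (C + 1) → LinkConfig H) (e : H.edgeSet)
    (he : edgeState (slot e) (slotCounts cs e) = .crossed)
    (hadj : ∀ f : H.edgeSet, (∃ v, v ∈ (e : Sym2 W) ∧ v ∈ (f : Sym2 W)) →
      edgeState (slot f) (slotCounts cs f) ≠ .mixed) :
    IsCancelled (List.ofFn cs).flatten e := by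
  have hcount : ∀ j t, (cs j).count (e, t) = crossPair (slot e).castSucc j t := fun j t =>
    congrFun (congrFun (edgeState_eq_crossed.1 he) j) t
  refine isCancelled_flatten cs (slot e).castSucc ?_ ?_ ?_ ?_
  · intro j hj h
    obtain ⟨t, ht⟩ := (mem_map_fst_iff _ _).1 h
    exact ht (by rw [hcount]; simp [crossPair, hj])
  · rintro ⟨f, t⟩ hl rfl
    by_contra ht
    have h0 := hcount (slot f).castSucc t
    simp only [crossPair, ht, and_false, if_false] at h0
    exact List.count_eq_zero.1 h0 hl
  · rw [count_map_fst, hcount, hcount]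
    simp [crossPair]
  · intro f hf hfe v hvf hve
    obtain ⟨t, ht⟩ := (mem_map_fst_iff _ _).1 hf
    have hmix := hadj f ⟨v, hve, hvf⟩
    cases hs : edgeState (slot f) (slotCounts cs f) with
    | mixed => exact hmix hs
    | closed =>
      exact ht (congrFun (congrFun (edgeState_eq_closed.1 hs) _) t)
    | late =>
      exact ht (congrFun (edgeState_closed_or_late.1 (Or.inr hs) _) t)
    | crossed =>
      refine ht ((congrFun (congrFun (edgeState_eq_crossed.1 hs) _) t).trans ?_)
      have : slot e ≠ slot f := hslot e f (Ne.symm hfe) ⟨v, hve, hvf⟩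
      simp [crossPair, this]

-- At `θ = 1` the loop factor disappears and the weight is that of a Poisson sequence.
omit [DecidableEq H.edgeSet] in
theorem weight_eq_listWeight {β u : ℝ} (hβ : 0 ≤ β) (c : LinkConfig H) :
    weight H β u 1 c = listWeight β (fun l : H.edgeSet × Bool => typeWeight u l.2) c := by
  have h : (c.map fun l : H.edgeSet × Bool => typeWeight u l.2).prod
      = u ^ c.countP (fun l => l.2) * (1 - u) ^ c.countP (fun l => !l.2) := by
    induction c with
    | nil => simp
    | cons l c ih =>
      obtain ⟨f, t⟩ := l
      rw [List.map_cons, List.prod_cons, ih]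
      cases t <;> simp [typeWeight, pow_succ] <;> ring
  unfold weight listWeight poissonWeight
  rw [h, one_pow, mul_one, mul_assoc, ENNReal.ofReal_mul (by positivity)]

variable [Fintype H.edgeSet]

theorem tsum_weight {β u : ℝ} (hβ : 0 ≤ β) (hu : u ∈ Set.Icc (0 : ℝ) 1) :
    ∑' c, weight H β u 1 c = ENNReal.ofReal (Real.exp β) ^ Fintype.card H.edgeSet := by
  have h := tsum_listWeight_count hβ (fun l : H.edgeSet × Bool => typeWeight u l.2)
    (fun l => typeWeight_nonneg hu _) fun _ => 1
  simp only [mul_one] at h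
  rw [tsum_congr fun c => weight_eq_listWeight hβ c, h,
    tsum_prod_pi fun (l : H.edgeSet × Bool) k => poissonWeight (β * typeWeight u l.2) k,
    Fintype.prod_prod_type, Finset.prod_congr rfl fun e _ => (tsum_prod_pi
      fun t k => poissonWeight (β * typeWeight u t) k).symm.trans (tsum_prod_typeWeight hβ hu),
    Finset.prod_const, Finset.card_univ]

/-- The edges that meet `e`, including `e` itself. -/
def edgeNeighbours (e : H.edgeSet) : Finset H.edgeSet :=
  open Classical in Finset.univ.filter fun f => ∃ v, v ∈ (e : Sym2 W) ∧ v ∈ (f : Sym2 W)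

omit [DecidableEq H.edgeSet] in
theorem mem_edgeNeighbours {e f : H.edgeSet} :
    f ∈ edgeNeighbours e ↔ ∃ v, v ∈ (e : Sym2 W) ∧ v ∈ (f : Sym2 W) := by
  simp [edgeNeighbours]

omit [DecidableEq H.edgeSet] in
theorem self_mem_edgeNeighbours (e : H.edgeSet) : e ∈ edgeNeighbours e :=
  mem_edgeNeighbours.2 ⟨_, Sym2.out_fst_mem _, Sym2.out_fst_mem _⟩

omit [DecidableEq H.edgeSet] in
theorem edgeNeighbours_symm (e f : H.edgeSet) (h : f ∈ edgeNeighbours e) :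
    e ∈ edgeNeighbours f := by
  obtain ⟨v, h1, h2⟩ := mem_edgeNeighbours.1 h
  exact mem_edgeNeighbours.2 ⟨v, h2, h1⟩

open Classical in
/-- The edges that are neither closed nor cancelled according to the edge states. -/
def stateEdges (σ : H.edgeSet → EdgeState) : Finset H.edgeSet :=
  Finset.univ.filter fun e => σ e ≠ .closed ∧
    ¬ (σ e = .crossed ∧ ∀ f ∈ edgeNeighbours e, σ f ≠ .mixed)

theorem mem_stateEdges {σ : H.edgeSet → EdgeState} {e : H.edgeSet} :
    e ∈ stateEdges σ ↔ σ e ≠ .closed ∧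
      ¬ (σ e = .crossed ∧ ∀ f ∈ edgeNeighbours e, σ f ≠ .mixed) := by
  simp only [stateEdges, Finset.mem_filter, Finset.mem_univ, true_and]

open Classical in
/-- The edges that carry a link and are not cancelled, as a finite set. -/
def effectiveFinset (c : LinkConfig H) : Finset H.edgeSet :=
  Finset.univ.filter fun e => e ∈ effectiveEdges c

theorem mem_effectiveFinset {c : LinkConfig H} {e : H.edgeSet} :
    e ∈ effectiveFinset c ↔ e ∈ effectiveEdges c := by
  simp [effectiveFinset]

/-- In general only an inclusion: a closed neighbour whose `P` bit is false expels an edge from the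
core although it does not obstruct cancellation. -/
theorem stateEdges_stateOfBits_subset (x : H.edgeSet → Bool × Bool × Bool) :
    stateEdges (fun e => stateOfBits (x e)) ⊆ (Finset.univ.filter fun e => (x e).1) \
      core edgeNeighbours (Finset.univ.filter fun e => (x e).2.1)
        (Finset.univ.filter fun e => (x e).2.2) := by
  intro e he
  obtain ⟨h1, h2⟩ := mem_stateEdges.1 he
  have hO : (x e).1 = true := by
    by_contra h
    refine h1 ?_
    rcases hx : x e with ⟨o, p, t⟩
    rw [hx, Bool.not_eq_true] at h
    obtain rfl : o = false := h
    rfl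
  simp only [Finset.mem_sdiff, Finset.mem_filter, Finset.mem_univ, true_and, mem_core, not_and]
  refine ⟨hO, fun hX hN => h2 ⟨?_, fun f hf => ?_⟩⟩
  · have hP := (Finset.mem_filter.1 (hN (self_mem_edgeNeighbours e))).2
    rcases hx : x e with ⟨o, p, t⟩
    rw [hx] at hO hX hP
    obtain rfl : o = true := hO
    obtain rfl : p = true := hP
    obtain rfl : t = true := hX
    rfl
  · have hP := (Finset.mem_filter.1 (hN hf)).2
    rcases hx : x f with ⟨o, p, t⟩
    rw [hx] at hP
    obtain rfl : p = true := hP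
    cases o <;> cases t <;> simp [stateOfBits]

theorem effectiveFinset_subset_stateEdges {C : ℕ} (slot : H.edgeSet → Fin C)
    (hslot : ∀ e f : H.edgeSet, e ≠ f → f ∈ edgeNeighbours e → slot e ≠ slot f)
    (cs : Fin (C + 1) → LinkConfig H) :
    effectiveFinset (List.ofFn cs).flatten
      ⊆ stateEdges fun e => edgeState (slot e) (slotCounts cs e) := by
  intro e he
  obtain ⟨hmem, hcan⟩ := mem_effectiveFinset.1 he
  refine mem_stateEdges.2 ⟨fun h => ?_, fun h => hcan ?_⟩
  · obtain ⟨l, hl, rfl⟩ := List.mem_map.1 hmem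
    obtain ⟨c, hc, hlc⟩ := List.mem_flatten.1 hl
    obtain ⟨j, rfl⟩ := List.mem_ofFn.1 hc
    have h0 := congrFun (congrFun (edgeState_eq_closed.1 h) j) l.2
    exact List.count_eq_zero.1 h0 hlc
  · exact isCancelled_of_edgeState slot (fun e f hef hv => hslot e f hef (mem_edgeNeighbours.2 hv))
      cs e h.1 fun f hf => h.2 f (mem_edgeNeighbours.2 hf)

/-- An event that forces an increasing event of the effective edges is at most as likely as that
event is for a Bernoulli field. -/
theorem loopMeasure_le_bernoulliSum [Finite W] {β u : ℝ} (hβ : 0 ≤ β)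
    (hu : u ∈ Set.Icc (0 : ℝ) 1) {C : ℕ} {b : Fin (C + 1) → ℝ} (hb : ∀ j, 0 ≤ b j)
    (hsum : ∑ j, b j = β) {a r s d : ℝ} (ha0 : 0 ≤ a) (ha1 : a ≤ 1) (hr0 : 0 ≤ r)
    (hr1 : r ≤ 1) (hs0 : 0 ≤ s) (hs1 : s ≤ 1) (hd0 : 0 ≤ d) (hd1 : d ≤ 1)
    (h1 : Real.exp β * (1 - a) = 1)
    (h2 : ∀ i : Fin C, Real.exp β * (a * (r * s)) = (b i.castSucc * u) ^ 2 / 2)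
    (h3 : Real.exp β * (a * (r * (1 - s))) = Real.exp (b (Fin.last C)) - 1)
    {m : ℕ} (hcard : ∀ e : H.edgeSet, (edgeNeighbours e).card ≤ m)
    (hd : d ≤ r ^ m * (s * (1 - s) ^ (m * m)))
    (slot : H.edgeSet → Fin C)
    (hslot : ∀ e f : H.edgeSet, e ≠ f → f ∈ edgeNeighbours e → slot e ≠ slot f)
    {f : Finset H.edgeSet → ℝ} (hf : Monotone f) (hf0 : ∀ D, 0 ≤ f D) (A : Set (LinkConfig H))
    (hA : ∀ c ∈ A, 1 ≤ f (effectiveFinset c)) :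
    (loopMeasure H β u 1 one_pos).toOuterMeasure A
      ≤ ENNReal.ofReal (bernoulliSum (a * (1 - d)) Finset.univ f) := by
  have hbits : ∀ x, 0 ≤ bitsWeight a r s x := fun x => mul_nonneg (bitWeight_nonneg ha0 ha1 _)
    (mul_nonneg (bitWeight_nonneg hr0 hr1 _) (bitWeight_nonneg hs0 hs1 _))
  have key : ∑' c, A.indicator (weight H β u 1) c
      ≤ ENNReal.ofReal (Real.exp β) ^ Fintype.card H.edgeSet
        * ENNReal.ofReal (bernoulliSum (a * (1 - d)) Finset.univ f) := by
    calc ∑' c, A.indicator (weight H β u 1) c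
        ≤ ∑' c, listWeight (∑ j, b j) (fun l : H.edgeSet × Bool => typeWeight u l.2) c
            * ENNReal.ofReal (f (effectiveFinset c)) := by
          refine ENNReal.tsum_le_tsum fun c => ?_
          by_cases hc : c ∈ A
          · rw [Set.indicator_of_mem hc, weight_eq_listWeight hβ, hsum]
            refine le_mul_of_one_le_right zero_le ?_
            rw [← ENNReal.ofReal_one]
            exact ENNReal.ofReal_le_ofReal (hA c hc)
          · rw [Set.indicator_of_notMem hc]
            exact zero_le
      _ = ∑' cs : Fin (C + 1) → LinkConfig H,
            (∏ j, listWeight (b j) (fun l : H.edgeSet × Bool => typeWeight u l.2) (cs j))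
            * ENNReal.ofReal (f (effectiveFinset (List.ofFn cs).flatten)) :=
          (tsum_listWeight_flatten b hb _ (fun l => typeWeight_nonneg hu _) fun c =>
            ENNReal.ofReal (f (effectiveFinset c))).symm
      _ ≤ ∑' cs : Fin (C + 1) → LinkConfig H,
            (∏ j, listWeight (b j) (fun l : H.edgeSet × Bool => typeWeight u l.2) (cs j))
            * ENNReal.ofReal (f (stateEdges fun e =>
                edgeState (slot e) (slotCounts cs e))) := by
          refine ENNReal.tsum_le_tsum fun cs => ?_
          gcongr
          exact hf (effectiveFinset_subset_stateEdges slot hslot cs)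
      _ = ENNReal.ofReal (Real.exp (∑ j, b j)) ^ Fintype.card H.edgeSet
            * ENNReal.ofReal (∑ x : H.edgeSet → Bool × Bool × Bool,
              (∏ e, bitsWeight a r s (x e)) * f (stateEdges fun e => stateOfBits (x e))) :=
          tsum_listWeight_bits hb hu ha0 ha1 hr0 hr1 hs0 hs1 slot (hsum ▸ h1) (hsum ▸ h2)
            (hsum ▸ h3) (fun σ => f (stateEdges σ)) fun σ => hf0 _
      _ ≤ _ := by
          rw [hsum]
          gcongr
          refine le_trans (Finset.sum_le_sum fun x _ => ?_) ((sum_bitsWeight a r s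
            fun O P X => f (O \ core edgeNeighbours P X)).le.trans
            (bernoulliSum_sdiff_core_le edgeNeighbours hcard edgeNeighbours_symm ha0 ha1 hr0 hr1
              hs0 hs1 hd0 hd1 hd hf))
          exact mul_le_mul_of_nonneg_left (hf (stateEdges_stateOfBits_subset x))
            (Finset.prod_nonneg fun e _ => hbits _)
  have hZ0 : ENNReal.ofReal (Real.exp β) ^ Fintype.card H.edgeSet ≠ 0 :=
    pow_ne_zero _ (by simpa using Real.exp_pos β)
  have hZt : ENNReal.ofReal (Real.exp β) ^ Fintype.card H.edgeSet ≠ ∞ :=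
    ENNReal.pow_ne_top ENNReal.ofReal_ne_top
  rw [PMF.toOuterMeasure_apply]
  have hind : ∀ c, A.indicator (loopMeasure H β u 1 one_pos) c
      = A.indicator (weight H β u 1) c
        * (ENNReal.ofReal (Real.exp β) ^ Fintype.card H.edgeSet)⁻¹ := by
    intro c
    by_cases hc : c ∈ A
    · rw [Set.indicator_of_mem hc, Set.indicator_of_mem hc, loopMeasure, PMF.normalize_apply,
        tsum_weight hβ hu]
    · rw [Set.indicator_of_notMem hc, Set.indicator_of_notMem hc, zero_mul]
  rw [tsum_congr hind, ENNReal.tsum_mul_right]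
  refine (mul_le_mul_left key _).trans ?_
  rw [mul_comm, ← mul_assoc, ENNReal.inv_mul_cancel hZ0 hZt, one_mul]

end Comparison

/-! ### Greedy colouring -/

/-- A finite symmetric relation whose closed neighbourhoods have at most `C` elements has a proper
colouring with `C` colours. -/
theorem exists_colouring {E : Type*} [Fintype E] [DecidableEq E] (N : E → Finset E)
    (hself : ∀ e, e ∈ N e) (hsymm : ∀ e f, f ∈ N e → e ∈ N f) {C : ℕ} (hC : 0 < C)
    (hcard : ∀ e, (N e).card ≤ C) :
    ∃ col : E → Fin C, ∀ e f, e ≠ f → f ∈ N e → col e ≠ col f := by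
  suffices h : ∀ S : Finset E, ∃ col : E → Fin C,
      ∀ e ∈ S, ∀ f ∈ S, e ≠ f → f ∈ N e → col e ≠ col f by
    obtain ⟨col, hcol⟩ := h Finset.univ
    exact ⟨col, fun e f => hcol e (Finset.mem_univ _) f (Finset.mem_univ _)⟩
  intro S
  induction S using Finset.induction_on with
  | empty => exact ⟨fun _ => ⟨0, hC⟩, by simp⟩
  | insert e S he ih =>
    obtain ⟨col, hcol⟩ := ih
    -- Since `e ∈ N e`, at most `C - 1` colours are forbidden.
    have hlt : (((N e).erase e).image col).card < (Finset.univ : Finset (Fin C)).card := by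
      refine Finset.card_image_le.trans_lt ?_
      rw [Finset.card_erase_of_mem (hself e), Finset.card_univ, Fintype.card_fin]
      have := hcard e
      omega
    obtain ⟨x, _, hx⟩ := Finset.exists_mem_notMem_of_card_lt_card hlt
    have hx' : ∀ f, f ≠ e → f ∈ N e → col f ≠ x := fun f h1 h2 h3 =>
      hx (Finset.mem_image.2 ⟨f, Finset.mem_erase.2 ⟨h1, h2⟩, h3⟩)
    refine ⟨Function.update col e x, fun f hf g hg hfg hN => ?_⟩
    rcases Finset.mem_insert.1 hf with rfl | hf
    · rw [Function.update_self, Function.update_of_ne hfg.symm]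
      exact (hx' g hfg.symm hN).symm
    · by_cases hge : g = e
      · subst hge
        rw [Function.update_self, Function.update_of_ne hfg]
        exact hx' f hfg (hsymm _ _ hN)
      · have hfe : f ≠ e := fun h => he (h ▸ hf)
        rw [Function.update_of_ne hfe, Function.update_of_ne hge]
        exact hcol f hf g ((Finset.mem_insert.1 hg).resolve_left hge) hfg hN

/-! ### Finite marginals of Bernoulli percolation -/

section Percolation

open MeasureTheory ProbabilityTheory

variable {S E : Type*} [Fintype E] [DecidableEq E]

open Classical in
/-- The trace of a set of open edges on a finite family of edges. -/
def trace (ι : E → S) (ω : Set S) : Finset E := Finset.univ.filter fun e => ι e ∈ ω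

omit [DecidableEq E] in
theorem mem_trace {ι : E → S} {ω : Set S} {e : E} : e ∈ trace ι ω ↔ ι e ∈ ω := by simp [trace]

omit [DecidableEq E] in
theorem image_trace (ι : E → S) (ω : Set S) :
    ι '' (trace ι ω : Set E) = ω ∩ Set.range ι := by
  ext x
  simp only [Set.mem_inter_iff, Set.mem_range, Set.mem_image, Finset.mem_coe, mem_trace]
  constructor
  · rintro ⟨e, h1, rfl⟩
    exact ⟨h1, e, rfl⟩
  · rintro ⟨h1, e, rfl⟩
    exact ⟨e, h1, rfl⟩

/-- The event is a cylinder over the finitely many coordinates in the range of `ι`, so its measure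
is a finite product. -/
theorem setBernoulli_mem (u : Set S) (p : unitInterval) (ι : E → S) (hι : Function.Injective ι)
    (hu : ∀ e, ι e ∈ u) (D : Finset E) :
    setBernoulli u p {ω | trace ι ω = D}
      = ENNReal.ofReal ((p : ℝ) ^ D.card * (1 - p) ^ (Finset.univ \ D).card) := by
  classical
  rw [setBernoulli_apply']
  have hset : ((fun q : S → Prop => {i | q i}) ⁻¹' {ω | trace ι ω = D})
      = Set.pi (Finset.univ.image ι : Finset S) fun i => {i ∈ D.image ι} := by
    ext q
    simp only [Set.mem_preimage, Set.mem_ofPred_eq, Set.mem_pi, Finset.coe_image, Finset.coe_univ,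
      Set.image_univ, Set.mem_range, forall_exists_index, forall_apply_eq_imp_iff,
      Set.mem_singleton_iff, Finset.ext_iff, mem_trace, eq_iff_iff, Finset.mem_image,
      hι.eq_iff, exists_eq_right]
  rw [hset, Measure.infinitePi_pi _ fun _ _ => MeasurableSet.of_discrete,
    Finset.prod_image fun _ _ _ _ h => hι h]
  have hterm : ∀ e : E, (unitInterval.toNNReal p • Measure.dirac (ι e ∈ u)
        + unitInterval.toNNReal (unitInterval.symm p) • Measure.dirac False)
        ({ι e ∈ D.image ι} : Set Prop)
      = ENNReal.ofReal (if e ∈ D then (p : ℝ) else 1 - p) := by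
    intro e
    have h1 : (ι e ∈ D.image ι) ↔ e ∈ D := by simp [hι.eq_iff]
    by_cases he : e ∈ D
    · simp only [h1, he, hu, if_true]
      refine Eq.trans ?_ (ENNReal.ofReal_eq_coe_nnreal p.2.1).symm
      simp
      rfl
    · simp only [h1, he, hu, if_false]
      refine Eq.trans ?_ (ENNReal.ofReal_eq_coe_nnreal (sub_nonneg.2 p.2.2)).symm
      simp
      rfl
  rw [Finset.prod_congr rfl fun e _ => hterm e, ← ENNReal.ofReal_prod_of_nonneg]
  · congr 1
    rw [Finset.prod_ite, Finset.prod_const, Finset.prod_const]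
    congr 3
    · ext; simp
    · ext; simp
  · intro e _
    split_ifs
    · exact p.2.1
    · linarith [p.2.2]

omit [DecidableEq E] in
theorem measurableSet_trace (ι : E → S) (A : Set (Finset E)) :
    MeasurableSet {ω : Set S | trace ι ω ∈ A} := by
  have h : ∀ D : Finset E, MeasurableSet {ω : Set S | trace ι ω = D} := fun D => by
    have : {ω : Set S | trace ι ω = D} = ⋂ e : E, {ω | ι e ∈ ω ↔ e ∈ D} := by
      ext ω
      simp [Finset.ext_iff, mem_trace]
    rw [this]
    refine MeasurableSet.iInter fun e => ?_
    by_cases he : e ∈ D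
    · simpa [he] using measurableSet_mem (ι e)
    · simpa [he] using measurableSet_notMem (ι e)
  have h2 : {ω : Set S | trace ι ω ∈ A} = ⋃ D ∈ A, {ω : Set S | trace ι ω = D} := by
    ext ω
    simp
  rw [h2]
  exact MeasurableSet.biUnion (Set.to_countable A) fun D _ => h D

open Classical in
/-- The law of the trace of Bernoulli percolation on finitely many edges. -/
theorem setBernoulli_trace (u : Set S) (p : unitInterval) (ι : E → S) (hι : Function.Injective ι)
    (hu : ∀ e, ι e ∈ u) (A : Set (Finset E)) :
    setBernoulli u p {ω | trace ι ω ∈ A}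
      = ENNReal.ofReal (bernoulliSum p Finset.univ fun D => if D ∈ A then 1 else 0) := by
  have h2 : {ω : Set S | trace ι ω ∈ A}
      = ⋃ D ∈ Finset.univ.filter (· ∈ A), {ω : Set S | trace ι ω = D} := by
    ext ω
    simp
  have hp : (0 : ℝ) ≤ 1 - p := sub_nonneg.2 p.2.2
  rw [h2, measure_biUnion_finset]
  · rw [Finset.sum_congr rfl fun D _ => setBernoulli_mem u p ι hι hu D, bernoulliSum,
      Finset.powerset_univ, ← ENNReal.ofReal_sum_of_nonneg, Finset.sum_filter]
    · congr 1
      exact Finset.sum_congr rfl fun D _ => by split_ifs <;> simp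
    · exact fun D _ => mul_nonneg (pow_nonneg p.2.1 _) (pow_nonneg hp _)
  · intro D _ D' _ hne
    refine Set.disjoint_left.2 fun ω h1 h2 => hne ?_
    exact (show trace ι ω = D from h1).symm.trans h2
  · exact fun D _ => measurableSet_trace ι {D}

end Percolation

/-! ### Percolation along an exhaustion -/

section Reach

open MeasureTheory ProbabilityTheory

variable {V : Type*} (G : SimpleGraph V)

/-- The edges of an induced subgraph as edges of the whole graph. -/
def inducedEdge (S : Finset V) (e : (G.induce (S : Set V)).edgeSet) : Sym2 V :=
  Sym2.map Subtype.val e.1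

theorem inducedEdge_injective (S : Finset V) : Function.Injective (inducedEdge G S) :=
  fun _ _ h => Subtype.ext (Sym2.map.injective Subtype.val_injective h)

theorem inducedEdge_mem (S : Finset V) (e : (G.induce (S : Set V)).edgeSet) :
    inducedEdge G S e ∈ G.edgeSet := by
  obtain ⟨e, he⟩ := e
  induction e using Sym2.ind with
  | _ v w => exact he

/-- The set `T` of edges connects `v₀` to a vertex at distance at least `R`. -/
def connectsToDistance (v₀ : V) (R : ℕ) (T : Set (Sym2 V)) : Prop :=
  ∃ w, R ≤ G.dist v₀ w ∧ (SimpleGraph.fromEdgeSet T).Reachable v₀ w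

variable {G}

theorem connectsToDistance.mono {v₀ : V} {R : ℕ} {T T' : Set (Sym2 V)} (hT : T ⊆ T')
    (h : connectsToDistance G v₀ R T) : connectsToDistance G v₀ R T' := by
  obtain ⟨w, hw, hr⟩ := h
  exact ⟨w, hw, hr.mono (SimpleGraph.fromEdgeSet_mono hT)⟩

/-- `LoopConnected.reachable` transported to `V`: distances are measured in `G`, not in the induced
subgraph. -/
theorem connectsToDistance_of_reachesDistance {S : Finset V}
    [DecidableEq (G.induce (S : Set V)).edgeSet] {v₀ : V} {R : ℕ}
    {c : LinkConfig (G.induce (S : Set V))} (h : c ∈ reachesDistance G S v₀ R) :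
    connectsToDistance G v₀ R (inducedEdge G S '' effectiveEdges c) := by
  obtain ⟨v, w, rfl, hw, hc⟩ := h
  refine ⟨w, hw, ?_⟩
  let φ : effectiveGraph c →g SimpleGraph.fromEdgeSet (inducedEdge G S '' effectiveEdges c) :=
    { toFun := Subtype.val
      map_rel' := by
        intro x y hxy
        obtain ⟨⟨e, he, hxy⟩, hne⟩ := (SimpleGraph.fromEdgeSet_adj _).1 hxy
        refine (SimpleGraph.fromEdgeSet_adj _).2 ⟨⟨e, he, ?_⟩, fun h => hne (Subtype.ext h)⟩
        rw [inducedEdge, hxy, Sym2.map_mk] }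
  exact hc.reachable.map φ

/-- Infinitely long connections from `v₀` need an infinite cluster. -/
theorem mem_hasInfiniteCluster {v₀ : V} {ω : Set (Sym2 V)}
    (h : ∀ R, connectsToDistance G v₀ R ω) : ω ∈ hasInfiniteCluster V := by
  refine ⟨v₀, fun hfin => ?_⟩
  obtain ⟨M, hM⟩ := (hfin.image fun w => G.dist v₀ w).bddAbove
  obtain ⟨w, hw, hr⟩ := h (M + 1)
  have := hM (Set.mem_image_of_mem (fun w => G.dist v₀ w) (show w ∈ {w | _} from hr))
  have h2 : G.dist v₀ w ≤ M := this
  omega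

/-- If Bernoulli percolation bounds the connection probabilities in all `Λ m` and has no infinite
cluster, then there is no loop percolation. -/
theorem not_loopPercolation_of_le {Λ : ℕ → Finset V} {v₀ : V} {β u : ℝ} {p : unitInterval}
    (hp : setBernoulli G.edgeSet p (hasInfiniteCluster V) = 0)
    (hle : ∀ m R, (loopMeasure (G.induce (Λ m : Set V)) β u 1 one_pos).toOuterMeasure
        (reachesDistance G (Λ m) v₀ R)
      ≤ setBernoulli G.edgeSet p
        {ω | connectsToDistance G v₀ R (ω ∩ Set.range (inducedEdge G (Λ m)))}) :
    ¬ LoopPercolation G Λ v₀ β u 1 one_pos := by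
  classical
  set A : ℕ → ℕ → Set (Set (Sym2 V)) := fun R m =>
    {ω | connectsToDistance G v₀ R (ω ∩ Set.range (inducedEdge G (Λ m)))} with hA
  have hmeas : ∀ R, MeasurableSet (⋃ m, A R m) := fun R => by
    refine MeasurableSet.iUnion fun m => ?_
    have : Fintype (G.induce (Λ m : Set V)).edgeSet := Fintype.ofFinite _
    -- For fixed `m` the event depends on finitely many edges only.
    have h := measurableSet_trace (inducedEdge G (Λ m))
      {D | connectsToDistance G v₀ R (inducedEdge G (Λ m) '' D)}
    convert h using 1
    ext ω
    simp only [hA, Set.mem_ofPred_eq, image_trace]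
  have hanti : Antitone fun R => ⋃ m, A R m := fun R R' hR =>
    Set.iUnion_mono fun m ω ⟨w, hw, hr⟩ => ⟨w, hR.trans hw, hr⟩
  -- The union over `m` makes the bound independent of `m`, and continuity from above gives the
  -- limit in `R`.
  have hlim := tendsto_measure_iInter_atTop (μ := setBernoulli G.edgeSet p)
    (fun R => (hmeas R).nullMeasurableSet) hanti ⟨0, measure_ne_top _ _⟩
  have hzero : setBernoulli G.edgeSet p (⋂ R, ⋃ m, A R m) = 0 := by
    refine measure_mono_null (fun ω hω => ?_) hp
    refine mem_hasInfiniteCluster (G := G) (v₀ := v₀) fun R => ?_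
    obtain ⟨m, hm⟩ := Set.mem_iUnion.1 (Set.mem_iInter.1 hω R)
    exact connectsToDistance.mono Set.inter_subset_left hm
  rw [hzero] at hlim
  unfold LoopPercolation
  rw [not_lt, ← hlim.liminf_eq]
  refine Filter.liminf_le_liminf (Filter.Eventually.of_forall fun R => ?_)
  refine (Filter.liminf_le_liminf (v := fun _ : ℕ => setBernoulli G.edgeSet p (⋃ m, A R m))
    (Filter.Eventually.of_forall fun m => ?_)).trans (Filter.liminf_const _).le
  exact (hle m R).trans (measure_mono (Set.subset_iUnion (A R) m))

/-- Closed edge neighbourhoods in induced subgraphs of a graph of maximal degree `k + 1`. -/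
theorem card_edgeNeighbours_le [G.LocallyFinite] {k : ℕ} (hk : ∀ v, G.degree v ≤ k + 1)
    (S : Finset V) [Fintype (G.induce (S : Set V)).edgeSet]
    (e : (G.induce (S : Set V)).edgeSet) : (edgeNeighbours e).card ≤ 2 * k + 1 := by
  classical
  obtain ⟨v, w, hvw⟩ : ∃ v w : V, inducedEdge G S e = s(v, w) :=
    ⟨_, _, (Quot.out_eq (inducedEdge G S e)).symm⟩
  have hmem := inducedEdge_mem G S e
  have hsub : (edgeNeighbours e).image (inducedEdge G S)
      ⊆ G.incidenceFinset v ∪ G.incidenceFinset w := by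
    intro f hf
    obtain ⟨f, hfe, rfl⟩ := Finset.mem_image.1 hf
    obtain ⟨x, hxe, hxf⟩ := mem_edgeNeighbours.1 hfe
    have h1 : (x : V) ∈ inducedEdge G S e := Sym2.mem_map.2 ⟨x, hxe, rfl⟩
    have h2 : (x : V) ∈ inducedEdge G S f := Sym2.mem_map.2 ⟨x, hxf, rfl⟩
    rw [hvw] at h1
    rw [Finset.mem_union, SimpleGraph.mem_incidenceFinset, SimpleGraph.mem_incidenceFinset]
    rcases Sym2.mem_iff.1 h1 with h | h
    · exact Or.inl ⟨inducedEdge_mem G S f, h ▸ h2⟩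
    · exact Or.inr ⟨inducedEdge_mem G S f, h ▸ h2⟩
  -- The edge itself is counted at both ends, which turns `2 * (k + 1)` into `2 * k + 1`.
  have hinter : 1 ≤ (G.incidenceFinset v ∩ G.incidenceFinset w).card := by
    refine Finset.card_pos.2 ⟨inducedEdge G S e, ?_⟩
    rw [Finset.mem_inter, SimpleGraph.mem_incidenceFinset, SimpleGraph.mem_incidenceFinset]
    exact ⟨⟨hmem, by rw [hvw]; exact Sym2.mem_mk_left _ _⟩,
      ⟨hmem, by rw [hvw]; exact Sym2.mem_mk_right _ _⟩⟩
  have h1 := Finset.card_le_card hsub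
  rw [Finset.card_image_of_injective _ (inducedEdge_injective G S)] at h1
  have h2 := Finset.card_union_add_card_inter (G.incidenceFinset v) (G.incidenceFinset w)
  rw [SimpleGraph.card_incidenceFinset_eq_degree, SimpleGraph.card_incidenceFinset_eq_degree] at h2
  have h3 := hk v
  have h4 := hk w
  omega

end Reach

/-! ### The choice of the parameters -/

section Parameters

/-- Squaring the quadratic Taylor bound at `y / 2` leaves the excess `y * (y - 2) ^ 2 / 8 + y / 2 +
y ^ 4 / 64`. -/
theorem sq_add_one_le_exp {y : ℝ} (hy : 0 ≤ y) : y ^ 2 + 1 ≤ Real.exp y := by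
  have h1 := Real.quadratic_le_exp_of_nonneg (x := y / 2) (by linarith)
  have h2 : Real.exp y = Real.exp (y / 2) ^ 2 := by
    rw [← Real.exp_nat_mul]; congr 1; push_cast; ring
  have h3 : (1 + y / 2 + (y / 2) ^ 2 / 2) ^ 2 ≤ Real.exp (y / 2) ^ 2 :=
    pow_le_pow_left₀ (by positivity) h1 2
  rw [h2]
  refine le_trans ?_ h3
  nlinarith [mul_nonneg hy (sq_nonneg (y - 2)), pow_nonneg hy 4, pow_nonneg hy 3]

theorem delta_nonneg {K : ℕ} {β u : ℝ} (hβ : 0 < β) : 0 ≤ delta K β u := by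
  unfold delta
  have : 0 < Real.exp β - 1 := by linarith [Real.add_one_le_exp β]
  positivity

/-- Discards the slack in `delta`: the summand `β` in the denominator is dropped, and `16 * (2 * k +
1) ^ 2 ≤ 96 * (k + 1) ^ 2`. -/
theorem delta_succ_le {k : ℕ} {β u T : ℝ} (hβ : 0 < β)
    (hT : T = (β / (2 * ((2 * k + 1 : ℕ) : ℝ)) * u) ^ 2 / 2) :
    delta (k + 1) β u ≤
      1 / 2 * ((β / 2 / (Real.exp β - 1)) ^ (2 * k) * (T / (Real.exp β - 1))) := by
  have hx : 0 < Real.exp β - 1 := by linarith [Real.add_one_le_exp β]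
  set q := β / (Real.exp β - 1) with hq
  have hq0 : 0 < q := div_pos hβ hx
  have h1 : β / 2 / (Real.exp β - 1) = q / 2 := by rw [hq]; ring
  have h2 : T / (Real.exp β - 1) = q * (β * u ^ 2 / (8 * (2 * k + 1) ^ 2)) := by
    rw [hT, hq]; push_cast; field_simp; ring
  have h3 : (q / 2) ^ (2 * k) = q ^ (2 * k) / 4 ^ k := by
    rw [div_pow, pow_mul 2]; norm_num
  have h4 : 2 * (k + 1) - 1 = 2 * k + 1 := by omega
  unfold delta
  rw [h1, h2, h3, h4, ← hq, pow_succ q]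
  have h5 : β / (β + 3 * 4 ^ (k + 1 + 1)) ≤ β / (48 * 4 ^ k) := by
    refine div_le_div_of_nonneg_left hβ.le (by positivity) ?_
    rw [pow_succ, pow_succ]; linarith
  calc 1 / 2 * (u / ((k + 1 : ℕ) : ℝ)) ^ 2 * (β / (β + 3 * 4 ^ (k + 1 + 1))) * (q ^ (2 * k) * q)
      ≤ 1 / 2 * (u / ((k + 1 : ℕ) : ℝ)) ^ 2 * (β / (48 * 4 ^ k)) * (q ^ (2 * k) * q) := by
        gcongr
    _ = (q ^ (2 * k) * q) * β * u ^ 2 / (4 ^ k * (96 * (k + 1) ^ 2)) := by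
        push_cast; field_simp; ring
    _ ≤ (q ^ (2 * k) * q) * β * u ^ 2 / (4 ^ k * (16 * (2 * k + 1) ^ 2)) := by
        refine div_le_div_of_nonneg_left (by positivity) (by positivity) ?_
        have hk : (0 : ℝ) ≤ k := Nat.cast_nonneg k
        refine mul_le_mul_of_nonneg_left ?_ (by positivity)
        nlinarith
    _ = _ := by field_simp; ring

/-- Parameters for the comparison: the link types of an edge are encoded by independent bits with
probabilities `1 - exp (-β)`, `r` and `s`. -/
theorem exists_bit_parameters {k : ℕ} {β u : ℝ} (hβ : 0 < β) (hu : u ∈ Set.Icc (0 : ℝ) 1) :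
    ∃ r s : ℝ, 0 ≤ r ∧ r ≤ 1 ∧ 0 ≤ s ∧ s ≤ 1 ∧
      Real.exp β * ((1 - Real.exp (-β)) * (r * s))
        = (β / (2 * ((2 * k + 1 : ℕ) : ℝ)) * u) ^ 2 / 2 ∧
      Real.exp β * ((1 - Real.exp (-β)) * (r * (1 - s))) = Real.exp (β / 2) - 1 ∧
      delta (k + 1) β u
        ≤ r ^ (2 * k + 1) * (s * (1 - s) ^ ((2 * k + 1) * (2 * k + 1))) := by
  set n : ℕ := 2 * k + 1 with hn
  have hn1 : (1 : ℝ) ≤ n := by exact_mod_cast Nat.succ_le_succ (Nat.zero_le _)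
  -- Relative to the weight `1` of a closed edge, `T`, `Q` and `x` are the weights of a crossed
  -- edge, of a late edge and of all edges that carry a link.
  set T : ℝ := (β / (2 * (n : ℝ)) * u) ^ 2 / 2 with hT
  set Q : ℝ := Real.exp (β / 2) - 1 with hQ
  set x : ℝ := Real.exp β - 1 with hx
  have hx0 : 0 < x := by linarith [Real.add_one_le_exp β]
  have hQ1 : β / 2 ≤ Q := by linarith [Real.add_one_le_exp (β / 2)]
  have hQ0 : 0 < Q := by linarith
  have hQ2 : (β / 2) ^ 2 ≤ Q := by linarith [sq_add_one_le_exp (y := β / 2) (by linarith)]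
  have hT0 : 0 ≤ T := by positivity
  have hTn : 2 * (n * n) * T ≤ Q := by
    have : 2 * (n * n) * T = (β / 2) ^ 2 * u ^ 2 := by rw [hT]; field_simp
    rw [this]
    have hu2 : u ^ 2 ≤ 1 := pow_le_one₀ hu.1 hu.2
    nlinarith [sq_nonneg (β / 2)]
  have hTQ : T ≤ Q := by
    have hnn : 1 ≤ (n : ℝ) * n := by nlinarith
    nlinarith
  have hxQ : x = Q * (Q + 2) := by
    have : Real.exp β = Real.exp (β / 2) ^ 2 := by
      rw [← Real.exp_nat_mul]; congr 1; push_cast; ring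
    rw [hx, hQ, this]; ring
  have hxe : Real.exp β * (1 - Real.exp (-β)) = x := by
    rw [mul_sub, ← Real.exp_add, hx]; simp
  have hTQ0 : 0 < T + Q := by linarith
  have hs1 : T / (T + Q) ≤ 1 := (div_le_one hTQ0).2 (by linarith)
  have hs0 : 0 ≤ T / (T + Q) := by positivity
  have hrs : (T + Q) / x * (T / (T + Q)) = T / x := by field_simp
  -- The conditional probabilities of being not mixed given open, and of being crossed given open
  -- and not mixed.
  refine ⟨(T + Q) / x, T / (T + Q), by positivity, ?_, hs0, hs1, ?_, ?_, ?_⟩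
  · rw [div_le_one hx0, hxQ]; nlinarith
  · rw [hrs, ← mul_assoc, hxe]; field_simp
  · rw [← mul_assoc, hxe]; field_simp; ring
  · refine (delta_succ_le hβ hT).trans ?_
    -- Bernoulli's inequality with `2 * (n * n) * T ≤ Q`; this is the factor `1 / 2` in `delta`.
    have h1 : 1 / 2 ≤ (1 - T / (T + Q)) ^ (n * n) := by
      have h := one_add_mul_le_pow (a := -(T / (T + Q))) (by linarith) (n * n)
      rw [← sub_eq_add_neg] at h
      refine le_trans ?_ h
      have : ((n * n : ℕ) : ℝ) * (T / (T + Q)) ≤ 1 / 2 := by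
        rw [← mul_div_assoc, div_le_iff₀ hTQ0]; push_cast; linarith
      linarith
    have h2 : (β / 2 / x) ^ (2 * k) ≤ ((T + Q) / x) ^ (2 * k) := by
      gcongr; linarith
    calc 1 / 2 * ((β / 2 / x) ^ (2 * k) * (T / x))
        ≤ (1 - T / (T + Q)) ^ (n * n) * (((T + Q) / x) ^ (2 * k) * (T / x)) := by
          gcongr
      _ = _ := by rw [← hrs, hn, pow_succ ((T + Q) / x)]; ring

theorem delta_succ_le_one {k : ℕ} {β u : ℝ} (hβ : 0 < β) (hu : u ∈ Set.Icc (0 : ℝ) 1) :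
    delta (k + 1) β u ≤ 1 := by
  obtain ⟨r, s, hr0, hr1, hs0, hs1, -, -, hd⟩ := exists_bit_parameters (k := k) hβ hu
  have h : 0 ≤ 1 - s := by linarith
  exact hd.trans (mul_le_one₀ (pow_le_one₀ hr0 hr1) (mul_nonneg hs0 (pow_nonneg h _))
    (mul_le_one₀ hs1 (pow_nonneg h _) (pow_le_one₀ h (by linarith))))

end Parameters

/-! ### Assembly of the comparison -/

section LoopPercolation

open MeasureTheory ProbabilityTheory

/-- Connections by loops in a finite induced subgraph are at most as likely as open connections in
Bernoulli percolation with the reduced edge probability. -/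
theorem loopMeasure_reachesDistance_le {V : Type*} {G : SimpleGraph V} [G.LocallyFinite] {k : ℕ}
    (hk : ∀ v, G.degree v ≤ k + 1) {β u : ℝ} (hβ : 0 < β) (hu : u ∈ Set.Icc (0 : ℝ) 1)
    {p : unitInterval} (hp : (1 - Real.exp (-β)) * (1 - delta (k + 1) β u) ≤ p)
    (S : Finset V) (v₀ : V) (R : ℕ) :
    (loopMeasure (G.induce (S : Set V)) β u 1 one_pos).toOuterMeasure (reachesDistance G S v₀ R)
      ≤ setBernoulli G.edgeSet p
        {ω | connectsToDistance G v₀ R (ω ∩ Set.range (inducedEdge G S))} := by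
  classical
  let _ : Fintype (G.induce (S : Set V)).edgeSet := Fintype.ofFinite _
  let _ : DecidableEq (G.induce (S : Set V)).edgeSet := Classical.decEq _
  obtain ⟨r, s, hr0, hr1, hs0, hs1, h2, h3, hd⟩ := exists_bit_parameters (k := k) hβ hu
  have hcard := card_edgeNeighbours_le hk S
  obtain ⟨slot, hslot⟩ := exists_colouring (edgeNeighbours (H := G.induce (S : Set V)))
    self_mem_edgeNeighbours edgeNeighbours_symm (Nat.succ_pos (2 * k)) hcard
  have he1 : Real.exp (-β) ≤ 1 := Real.exp_le_one_iff.2 (by linarith)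
  have ha0 : 0 ≤ 1 - Real.exp (-β) := by linarith
  have ha1 : 1 - Real.exp (-β) ≤ 1 := by linarith [Real.exp_pos (-β)]
  have hd1 := delta_succ_le_one (k := k) hβ hu
  set f : Finset (G.induce (S : Set V)).edgeSet → ℝ := fun D =>
    if D ∈ {D : Finset (G.induce (S : Set V)).edgeSet |
      connectsToDistance G v₀ R (inducedEdge G S '' (D : Set _))} then 1 else 0 with hf
  have hf0 : ∀ D, 0 ≤ f D := fun D => by simp only [hf]; split_ifs <;> norm_num
  have hfm : Monotone f := by
    intro D D' hDD
    simp only [hf]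
    split_ifs with h1 h2
    · exact le_rfl
    · exact absurd (connectsToDistance.mono (Set.image_mono (Finset.coe_subset.2 hDD)) h1) h2
    · exact zero_le_one
    · exact le_rfl
  have hA : ∀ c ∈ reachesDistance G S v₀ R, 1 ≤ f (effectiveFinset c) := by
    intro c hc
    have h := connectsToDistance_of_reachesDistance hc
    have hcoe : (effectiveFinset c : Set _) = effectiveEdges c := by
      ext e
      rw [Finset.mem_coe, mem_effectiveFinset]
    rw [← hcoe] at h
    exact (if_pos h).ge
  -- Half of the time goes to the last slot, the other half is shared equally by the `2 * k + 1`
  -- colours.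
  set b : Fin (2 * k + 1 + 1) → ℝ :=
    Fin.lastCases (β / 2) fun _ => β / (2 * ((2 * k + 1 : ℕ) : ℝ)) with hb
  have hbl : b (Fin.last _) = β / 2 := by simp [hb]
  have hbc : ∀ i : Fin (2 * k + 1), b i.castSucc = β / (2 * ((2 * k + 1 : ℕ) : ℝ)) := fun i => by
    simp [hb]
  have hb0 : ∀ j, 0 ≤ b j := Fin.lastCases (by rw [hbl]; positivity)
    fun i => by rw [hbc]; positivity
  have hbs : ∑ j, b j = β := by
    rw [Fin.sum_univ_castSucc, hbl, Finset.sum_congr rfl fun i _ => hbc i, Finset.sum_const,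
      Finset.card_univ, Fintype.card_fin, nsmul_eq_mul]
    have : ((2 * k + 1 : ℕ) : ℝ) ≠ 0 := by positivity
    field_simp
    ring
  have h1 : Real.exp β * (1 - (1 - Real.exp (-β))) = 1 := by
    rw [sub_sub_cancel, ← Real.exp_add, add_neg_cancel, Real.exp_zero]
  refine (loopMeasure_le_bernoulliSum hβ.le hu hb0 hbs ha0 ha1 hr0 hr1 hs0 hs1 (delta_nonneg hβ)
    hd1 h1 (fun i => by rw [hbc, h2]) (by rw [hbl, h3]) hcard hd slot hslot hfm hf0 _ hA).trans ?_
  have htr := setBernoulli_trace G.edgeSet p (inducedEdge G S) (inducedEdge_injective G S)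
    (inducedEdge_mem G S) {D : Finset (G.induce (S : Set V)).edgeSet |
      connectsToDistance G v₀ R (inducedEdge G S '' (D : Set _))}
  simp only [Set.mem_ofPred_eq, image_trace] at htr
  rw [htr]
  refine ENNReal.ofReal_le_ofReal ?_
  exact bernoulliSum_le_of_le (mul_nonneg ha0 (by linarith)) hp p.2.2 _ hfm

end LoopPercolation

end RandomLoop
end

theorem theorem2 {V : Type*} [Infinite V] (G : SimpleGraph V) [G.LocallyFinite]
    (hG : G.Connected)
    (K : ℕ) (hK : IsGreatest (Set.range fun v : V => G.degree v) K)
    (Λ : ℕ → Finset V) (hmono : Monotone Λ) (hexh : ∀ v : V, ∃ m, v ∈ Λ m)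
    (hconn : ∀ m, (G.induce (Λ m : Set V)).Connected)
    (v₀ : V) (hv₀ : v₀ ∈ Λ 0)
    (β u : ℝ) (hβ : 0 < β) (hu : u ∈ Set.Icc (0 : ℝ) 1)
    (hlt : (1 - Real.exp (-β)) * (1 - RandomLoop.delta K β u) < RandomLoop.criticalValue G) :
    ¬ RandomLoop.LoopPercolation G Λ v₀ β u 1 one_pos := by
  have hdeg : ∀ v, G.degree v ≤ K := fun v => hK.2 ⟨v, rfl⟩
  -- An infinite connected graph has no vertex of degree `0`; writing `K = k + 1` avoids the
  -- truncated subtraction in `2 * K - 1`.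
  obtain ⟨k, rfl⟩ : ∃ k, K = k + 1 :=
    Nat.exists_eq_succ_of_ne_zero
      ((hG.preconnected.degree_pos_of_nontrivial v₀).trans_le (hdeg v₀)).ne'
  have hd1 := RandomLoop.delta_succ_le_one (k := k) hβ hu
  have hp0 : 0 ≤ (1 - Real.exp (-β)) * (1 - RandomLoop.delta (k + 1) β u) :=
    mul_nonneg (sub_nonneg.2 (Real.exp_le_one_iff.2 (by linarith))) (by linarith)
  unfold RandomLoop.criticalValue at hlt
  -- An empty set would have supremum `0` by convention, which is not above the nonnegative reduced
  -- density.
  obtain ⟨p, ⟨hp, hinf⟩, hlt'⟩ := exists_lt_of_lt_csSup (Set.nonempty_iff_ne_empty.2 fun h => by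
    rw [h, Real.sSup_empty] at hlt
    linarith) hlt
  exact RandomLoop.not_loopPercolation_of_le hinf fun m R =>
    RandomLoop.loopMeasure_reachesDistance_le hdeg hβ hu hlt'.le (Λ m) v₀ R
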